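/- Let $k$ be a field, $B$ a commutative $k$-algebra and $N$ a $B$-module; write $\otimes=\otimes_k$. **Extensions.** For a commutative ring $R$ and $R$-modules $X,Y$, let $\mathrm{Ex}^2_R(X,Y)$ be the set of classes of exact sequences of $R$-modules $0\to Y\to T_1\to T_0\to X\to 0$ under the equivalence relation generated by the morphisms of exact sequences that are the identity on $X$ and on $Y$; it represents $\mathrm{Ext}^2_R(X,Y)$. If $\vartheta$ is such a sequence and $\alpha:Y\to Y'$ is $R$-linear, $\alpha_*\vartheta$ denotes its pushout along $\alpha$. Let $\mathrm{Exal}_k(B,B)$ $(=H^1(k,B,B))$ be the set of equivalence classes of infinitesimal extensions $\xi=(0\to B\xrightarrow{i}E\xrightarrow{p}B\to 0)$, where $E$ is a commutative $k$-algebra, $p$ is a surjective homomorphism of $k$-algebras, $i$ is $k$-linear and injective with image $\ker p$, and $e\cdot i(b)=i(p(e)b)$ for all $e\in E$, $b\in B$; two of them are equivalent if there is a $k$-algebra homomorphism between their middle terms compatible with the maps $i$ and $p$. **The map $\psi:\mathrm{Exal}_k(B,B)\to\mathrm{Ex}^2_B(N,N)$.** Given $\xi$ as above, consider $N$ as an $E$-module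 via $p$ and choose an exact sequence of $E$-modules $0\to K\to F\to N\to 0$ with $F$ projective. Tensoring with $B$ gives the exact sequence of $B$-modules $$\vartheta=(0\to \mathrm{Tor}_1^E(B,N)\to B\otimes_E K\to B\otimes_E F\to N\to 0),\qquad \mathrm{Tor}_1^E(B,N)=\ker(B\otimes_E K\to B\otimes_E F).$$ Let $\partial:\mathrm{Tor}_1^E(B,N)\to B\otimes_E N=N$ be the connecting (snake) homomorphism of the exact sequence of $E$-modules $0\to B\xrightarrow{i}E\xrightarrow{p}B\to 0$. Put $\psi([\xi])=[\partial_*\vartheta]$. **Hochschild cohomology and the map $\gamma$.** Let $HH^2(B|k)=\mathrm{Ex}^2_{B\otimes B}(B,B)$, where $B$ is a $B\otimes B$-module via multiplication. Consider the start of the bar resolution $$0\to\ker d_1\to B\otimes B\otimes B\xrightarrow{d_1}B\otimes B\xrightarrow{d_0}B\to 0,\qquad d_1(b_0\otimes b_1\otimes b_2)=b_0b_1\otimes b_2-b_0\otimes b_1b_2,\quad d_0(b\otimes b')=bb',$$ where $B\otimes B$ acts on $B\otimes B\otimes B$ through the outer factors. The map $\gamma:\mathrm{Exal}_k(B,B)\to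 HH^2(B|k)$ sends $[\xi]$ to the class of the Hochschild cocycle of $\xi$: choose a $k$-linear section $\sigma$ of $p$, put $f(x,y)=i^{-1}(\sigma(x)\sigma(y)-\sigma(xy))$, let $\beta:\ker d_1\to B$ be the restriction of $b_0\otimes b_1\otimes b_2\mapsto f(b_0,b_1)b_2$ (equivalently, $\beta$ is the $B\otimes B$-linear map with $\beta(d_2(b\otimes x\otimes y\otimes b'))=b\,f(x,y)\,b'$, where $d_2$ is the next bar differential); then $\gamma([\xi])$ is the class of the pushout of the sequence above along $\beta$. **The map $s:HH^2(B|k)\to\mathrm{Ex}^2_B(N,N)$.** Every class in $HH^2(B|k)$ has a representative $0\to B\to T\to P\to B\to 0$ with $P$ free over $B\otimes B$; $s$ sends it to the class of the exact sequence $0\to N\to T\otimes_BN\to P\otimes_BN\to N\to 0$, where $T\otimes_B N$ and $P\otimes_B N$ are formed with the $B$-module structures of $T$ and $P$ through $b\mapsto 1\otimes b$, and are considered as $B$-modules through $b\mapsto b\otimes 1$. The maps $\psi$, $\gamma$ and $s$ do not depend on the choices. **Theorem.** For every field $k$, every commutative $k$-algebra $B$ and every $B$-module $N$, $$\psi=s\circ\gamma:\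 \mathrm{Exal}_k(B,B)\longrightarrow \mathrm{Ex}^2_B(N,N).$$ -/

import Mathlib

open scoped TensorProduct

universe a b c c' t t₀ t₁ u v w

/-- A Yoneda 2-extension `0 → N → T₁ → T₀ → M → 0` of the `R`-module `M` by the `R`-module `N`. -/
structure TwoExt (R : Type a) (M : Type b) (N : Type c) [CommRing R]
    [AddCommGroup M] [Module R M] [AddCommGroup N] [Module R N] where
  T₁ : Type t₁
  T₀ : Type t₀
  [addCommGroup₁ : AddCommGroup T₁]
  [module₁ : Module R T₁]
  [addCommGroup₀ : AddCommGroup T₀]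
  [module₀ : Module R T₀]
  ι : N →ₗ[R] T₁
  d : T₁ →ₗ[R] T₀
  ε : T₀ →ₗ[R] M
  ι_injective : Function.Injective ι
  exact₁ : Function.Exact ι d
  exact₀ : Function.Exact d ε
  ε_surjective : Function.Surjective ε

namespace TwoExt

attribute [instance] addCommGroup₁ module₁ addCommGroup₀ module₀

section Basic

variable {R : Type a} {M : Type b} {N : Type c} [CommRing R]
  [AddCommGroup M] [Module R M] [AddCommGroup N] [Module R N]

/-- `ϑ` and `ϑ'` are directly related: there is a morphism of exact sequences `ϑ → ϑ'` which is
the identity on both ends. -/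
def DirectRel (ϑ ϑ' : TwoExt.{a, b, c, t₀, t₁} R M N) : Prop :=
  ∃ (f₁ : ϑ.T₁ →ₗ[R] ϑ'.T₁) (f₀ : ϑ.T₀ →ₗ[R] ϑ'.T₀),
    (∀ n, f₁ (ϑ.ι n) = ϑ'.ι n) ∧ (∀ x, ϑ'.d (f₁ x) = f₀ (ϑ.d x)) ∧ (∀ y, ϑ'.ε (f₀ y) = ϑ.ε y)

/-- The submodule `{(α n, -ι n)}` of `N' × T₁`. -/
def pushoutRel {N' : Type c'} [AddCommGroup N'] [Module R N'] (ϑ : TwoExt.{a, b, c, t₀, t₁} R M N)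
    (α : N →ₗ[R] N') : Submodule R (N' × ϑ.T₁) :=
  LinearMap.range (α.prod (-ϑ.ι))

/-- The 2-extension `α_*(ϑ) = (0 → N' → N' ⊕_N T₁ → T₀ → M → 0)` of `M` by `N'` obtained from
`ϑ = (0 → N → T₁ → T₀ → M → 0)` by pushing out along `α : N → N'`. -/
def pushforward {N' : Type c'} [AddCommGroup N'] [Module R N']
    (ϑ : TwoExt.{a, b, c, t₀, t₁} R M N) (α : N →ₗ[R] N') :
    TwoExt.{a, b, c', t₀, max c' t₁} R M N' where
  T₁ := (N' × ϑ.T₁) ⧸ ϑ.pushoutRel α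
  T₀ := ϑ.T₀
  ι := (ϑ.pushoutRel α).mkQ ∘ₗ LinearMap.inl R N' ϑ.T₁
  d := (ϑ.pushoutRel α).liftQ (ϑ.d ∘ₗ LinearMap.snd R N' ϑ.T₁) (by
    rintro _ ⟨n, rfl⟩
    simpa using ϑ.exact₁.apply_apply_eq_zero n)
  ε := ϑ.ε
  ι_injective := by
    rw [injective_iff_map_eq_zero]
    intro n hn
    obtain ⟨m, hm⟩ := (Submodule.Quotient.mk_eq_zero _).1 hn
    have h₂ : ϑ.ι m = 0 := by simpa using congrArg Prod.snd hm
    have h₁ : α m = n := by simpa using congrArg Prod.fst hm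
    rw [← h₁, (injective_iff_map_eq_zero _).1 ϑ.ι_injective m h₂, map_zero]
  exact₁ := by
    intro x
    obtain ⟨⟨n, y⟩, rfl⟩ := Submodule.mkQ_surjective _ x
    constructor
    · intro h
      obtain ⟨m, rfl⟩ := (ϑ.exact₁ y).1 (by simpa using h)
      refine ⟨n + α m, ?_⟩
      simp only [LinearMap.comp_apply, LinearMap.inl_apply]
      rw [← sub_eq_zero, ← map_sub]
      exact (Submodule.Quotient.mk_eq_zero _).2 ⟨m, by simp⟩
    · rintro ⟨m, hm⟩
      rw [← hm]
      simp
  exact₀ := by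
    intro x
    rw [ϑ.exact₀ x]
    constructor
    · rintro ⟨y, rfl⟩
      exact ⟨(ϑ.pushoutRel α).mkQ (0, y), by simp⟩
    · rintro ⟨y, rfl⟩
      obtain ⟨⟨n, y⟩, rfl⟩ := Submodule.mkQ_surjective _ y
      exact ⟨y, by simp⟩
  ε_surjective := ϑ.ε_surjective

/-- A morphism of 2-extensions over the identity of `M` and over `f : N → N₂`, together with
compatible maps `N → N'` and `N₂ → N'` (compatible up to a map `h : T₁ → N'`), induces a
direct relation between the pushouts. -/
theorem directRel_pushforward {N' : Type c'} [AddCommGroup N'] [Module R N']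
    {N₂ : Type c} [AddCommGroup N₂] [Module R N₂]
    (ϑ : TwoExt.{a, b, c, t₀, t₁} R M N) (ϑ₂ : TwoExt.{a, b, c, t₀, t₁} R M N₂)
    (f : N →ₗ[R] N₂) (f₁ : ϑ.T₁ →ₗ[R] ϑ₂.T₁) (f₀ : ϑ.T₀ →ₗ[R] ϑ₂.T₀)
    (hι : ∀ n, f₁ (ϑ.ι n) = ϑ₂.ι (f n)) (hd : ∀ x, ϑ₂.d (f₁ x) = f₀ (ϑ.d x))
    (hε : ∀ y, ϑ₂.ε (f₀ y) = ϑ.ε y)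
    (α : N →ₗ[R] N') (α₂ : N₂ →ₗ[R] N') (h : ϑ.T₁ →ₗ[R] N')
    (hα : ∀ n, α n = α₂ (f n) + h (ϑ.ι n)) :
    DirectRel (ϑ.pushforward α) (ϑ₂.pushforward α₂) := by
  let g : ((N' × ϑ.T₁) ⧸ ϑ.pushoutRel α) →ₗ[R] ((N' × ϑ₂.T₁) ⧸ ϑ₂.pushoutRel α₂) :=
    (ϑ.pushoutRel α).liftQ ((ϑ₂.pushoutRel α₂).mkQ ∘ₗ
      ((LinearMap.fst R N' ϑ.T₁ + h ∘ₗ LinearMap.snd R N' ϑ.T₁).prod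
        (f₁ ∘ₗ LinearMap.snd R N' ϑ.T₁))) (by
      rintro _ ⟨n, rfl⟩
      rw [LinearMap.mem_ker, LinearMap.comp_apply]
      exact (Submodule.Quotient.mk_eq_zero _).2 ⟨f n, by simp [hα, hι]⟩)
  have hg : ∀ n y, g ((ϑ.pushoutRel α).mkQ (n, y)) = (ϑ₂.pushoutRel α₂).mkQ (n + h y, f₁ y) :=
    fun n y => by simp [g]
  refine ⟨g, f₀, ?_, ?_, hε⟩
  · intro n
    refine (hg n 0).trans ?_
    rw [map_zero, map_zero, add_zero]
    rfl
  · intro x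
    obtain ⟨⟨n, y⟩, rfl⟩ := Submodule.mkQ_surjective _ x
    exact (congrArg (ϑ₂.pushforward α₂).d (hg n y)).trans (hd y)

end Basic

section FreeCover

variable {R : Type v} {M : Type b} {N : Type c} [CommRing R]
  [AddCommGroup M] [Module R M] [AddCommGroup N] [Module R N]

/-- The canonical surjection from the free module on the set `T₀` to `T₀`. -/
noncomputable def cover (ϑ : TwoExt.{v, b, c, v, v} R M N) : (ϑ.T₀ →₀ R) →ₗ[R] ϑ.T₀ :=
  Finsupp.linearCombination R id

theorem cover_surjective (ϑ : TwoExt.{v, b, c, v, v} R M N) : Function.Surjective ϑ.cover :=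
  fun x => ⟨Finsupp.single x 1, by simp [cover]⟩

/-- The 2-extension `0 → N → T₁ ×_{T₀} P → P → M → 0` where `P` is the free module on the set
`T₀`; it is directly related to `ϑ`. -/
noncomputable def freeCover (ϑ : TwoExt.{v, b, c, v, v} R M N) : TwoExt.{v, b, c, v, v} R M N where
  T₁ := LinearMap.eqLocus (ϑ.d ∘ₗ LinearMap.fst R ϑ.T₁ (ϑ.T₀ →₀ R))
    (ϑ.cover ∘ₗ LinearMap.snd R ϑ.T₁ (ϑ.T₀ →₀ R))
  T₀ := ϑ.T₀ →₀ R
  ι := (LinearMap.inl R ϑ.T₁ (ϑ.T₀ →₀ R) ∘ₗ ϑ.ι).codRestrict _ (fun n => by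
    simpa using ϑ.exact₁.apply_apply_eq_zero n)
  d := LinearMap.snd R ϑ.T₁ (ϑ.T₀ →₀ R) ∘ₗ Submodule.subtype _
  ε := ϑ.ε ∘ₗ ϑ.cover
  ι_injective := by
    intro x y h
    apply ϑ.ι_injective
    simpa using congrArg (fun z => z.1.1) h
  exact₁ := by
    rintro ⟨⟨x, p⟩, h⟩
    constructor
    · intro hp
      have hp : p = 0 := hp
      subst hp
      have hx : ϑ.d x = 0 := by simpa using h
      obtain ⟨n, rfl⟩ := (ϑ.exact₁ x).1 hx
      exact ⟨n, rfl⟩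
    · rintro ⟨n, hn⟩
      rw [← hn]
      rfl
  exact₀ := by
    intro p
    constructor
    · intro hp
      obtain ⟨x, hx⟩ := (ϑ.exact₀ _).1 hp
      exact ⟨⟨(x, p), hx⟩, rfl⟩
    · rintro ⟨⟨⟨x, p⟩, h⟩, rfl⟩
      have h : ϑ.d x = ϑ.cover p := h
      change ϑ.ε (ϑ.cover p) = 0
      rw [← h]
      exact ϑ.exact₀.apply_apply_eq_zero x
  ε_surjective := ϑ.ε_surjective.comp ϑ.cover_surjective

instance (ϑ : TwoExt.{v, b, c, v, v} R M N) : Module.Free R ϑ.freeCover.T₀ :=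
  inferInstanceAs (Module.Free R (ϑ.T₀ →₀ R))

theorem directRel_freeCover (ϑ : TwoExt.{v, b, c, v, v} R M N) : DirectRel ϑ.freeCover ϑ :=
  ⟨LinearMap.fst R ϑ.T₁ (ϑ.T₀ →₀ R) ∘ₗ Submodule.subtype _, ϑ.cover, fun _ => rfl,
    fun x => x.2, fun _ => rfl⟩

theorem DirectRel.freeCover {ϑ ϑ' : TwoExt.{v, b, c, v, v} R M N} (h : DirectRel ϑ ϑ') :
    DirectRel ϑ.freeCover ϑ'.freeCover := by
  obtain ⟨f₁, f₀, h₁, h₂, h₃⟩ := h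
  have hc : ∀ p, ϑ'.cover (Finsupp.lmapDomain R R f₀ p) = f₀ (ϑ.cover p) := by
    intro p
    induction p using Finsupp.induction_linear with
    | zero => simp
    | add p q hp hq => simp only [map_add, hp, hq]
    | single x r => simp [cover]
  refine ⟨LinearMap.codRestrict _ ((f₁.prodMap (Finsupp.lmapDomain R R f₀)) ∘ₗ
    Submodule.subtype _) ?_, Finsupp.lmapDomain R R f₀, ?_, ?_, ?_⟩
  · rintro ⟨⟨x, p⟩, h⟩
    have h : ϑ.d x = ϑ.cover p := h
    change ϑ'.d (f₁ x) = ϑ'.cover (Finsupp.lmapDomain R R f₀ p)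
    rw [h₂, hc, h]
  · intro n
    apply Subtype.ext
    change (f₁ (ϑ.ι n), Finsupp.lmapDomain R R f₀ 0) = (ϑ'.ι n, 0)
    rw [h₁, map_zero]
  · rintro ⟨⟨x, p⟩, h⟩
    rfl
  · intro p
    exact (congrArg ϑ'.ε (hc p)).trans (h₃ _)

end FreeCover

end TwoExt

/-- `Ex²_R(M, N)`: the set of classes of 2-extensions of `M` by `N` for the equivalence relation
generated by being directly related. -/
def Ex2 (R : Type a) (M : Type b) (N : Type c) [CommRing R]
    [AddCommGroup M] [Module R M] [AddCommGroup N] [Module R N] : Type (max a b c (t + 1)) :=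
  Quot (TwoExt.DirectRel : TwoExt.{a, b, c, t, t} R M N → TwoExt.{a, b, c, t, t} R M N → Prop)

/-- The class of a 2-extension. -/
def Ex2.mk {R : Type a} {M : Type b} {N : Type c} [CommRing R]
    [AddCommGroup M] [Module R M] [AddCommGroup N] [Module R N]
    (ϑ : TwoExt.{a, b, c, t, t} R M N) : Ex2.{a, b, c, t} R M N :=
  Quot.mk _ ϑ

/-- An infinitesimal extension `0 → M → E → B → 0` of the `A`-algebra `B` by the `B`-module `M`. -/
structure InfExt (A : Type u) (B : Type v) (M : Type w) [CommRing A] [CommRing B] [Algebra A B]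
    [AddCommGroup M] [Module A M] [Module B M] where
  E : Type (max v w)
  [commRing : CommRing E]
  [algebra : Algebra A E]
  i : M →ₗ[A] E
  p : E →ₐ[A] B
  i_injective : Function.Injective i
  exact : Function.Exact i p
  p_surjective : Function.Surjective p
  mul_i : ∀ (e : E) (m : M), e * i m = i (p e • m)

namespace InfExt

attribute [instance] commRing algebra

variable {A : Type u} {B : Type v} {M : Type w} [CommRing A] [CommRing B] [Algebra A B]
    [AddCommGroup M] [Module A M] [Module B M]

/-- Equivalence of infinitesimal extensions: an `A`-algebra map `E → E'` (automatically bijective)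
compatible with the maps from `M` and to `B`. -/
def Equivalent (ξ ξ' : InfExt.{u, v, w} A B M) : Prop :=
  ∃ α : ξ.E →ₐ[A] ξ'.E, (∀ m, α (ξ.i m) = ξ'.i m) ∧ (∀ e, ξ'.p (α e) = ξ.p e)

/-- `B` as an algebra over the middle term of an infinitesimal extension, via `p`. -/
instance algebraBase (ξ : InfExt.{u, v, w} A B M) : Algebra ξ.E B := ξ.p.toRingHom.toAlgebra

theorem algebraMap_eq (ξ : InfExt.{u, v, w} A B M) (e : ξ.E) : algebraMap ξ.E B e = ξ.p e := rfl

end InfExt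

/-- `Exal_A(B, M)`: the set of equivalence classes of infinitesimal extensions. -/
def Exal (A : Type u) (B : Type v) (M : Type w) [CommRing A] [CommRing B] [Algebra A B]
    [AddCommGroup M] [Module A M] [Module B M] : Type (max u (v + 1) (w + 1)) :=
  Quot (InfExt.Equivalent : InfExt.{u, v, w} A B M → InfExt.{u, v, w} A B M → Prop)

/-- The class of an infinitesimal extension. -/
def Exal.mk {A : Type u} {B : Type v} {M : Type w} [CommRing A] [CommRing B] [Algebra A B]
    [AddCommGroup M] [Module A M] [Module B M] (ξ : InfExt.{u, v, w} A B M) : Exal A B M :=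
  Quot.mk _ ξ

namespace Psi

/-! Throughout, `E → B` is a surjective ring homomorphism, `g : F → N` is a surjective `E`-linear
map onto a `B`-module `N`, and `K = ker g`. -/

section Presentation

variable {E : Type a} {B : Type v} {N : Type w} {F : Type b} [CommRing E] [CommRing B] [Algebra E B]
  [AddCommGroup N] [Module B N] [Module E N] [IsScalarTower E B N] [AddCommGroup F] [Module E F]

/-- The map `B ⊗_E K → B ⊗_E F`. -/
noncomputable def incl (B : Type v) [CommRing B] [Algebra E B] (g : F →ₗ[E] N) :
    B ⊗[E] (LinearMap.ker g) →ₗ[B] B ⊗[E] F :=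
  (LinearMap.ker g).subtype.baseChange B

/-- `Tor₁^E(B, N)`, computed from a projective presentation `0 → K → F → N → 0` as the kernel of
`B ⊗_E K → B ⊗_E F`. -/
noncomputable abbrev Tor1 (B : Type v) [CommRing B] [Algebra E B] (g : F →ₗ[E] N) :
    Submodule B (B ⊗[E] (LinearMap.ker g)) :=
  LinearMap.ker (incl B g)

/-- The map `B ⊗_E F → B ⊗_E N = N`, `b ⊗ x ↦ b • g x`. -/
noncomputable def aug (B : Type v) [CommRing B] [Algebra E B] [Module B N] [IsScalarTower E B N]
    (g : F →ₗ[E] N) : B ⊗[E] F →ₗ[B] N :=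
  g.liftBaseChange B

theorem aug_tmul (g : F →ₗ[E] N) (b : B) (x : F) : aug B g (b ⊗ₜ x) = b • g x := by
  simp [aug]

theorem exact_incl_aug (hB : Function.Surjective (algebraMap E B)) (g : F →ₗ[E] N)
    (hg : Function.Surjective g) : Function.Exact (incl B g) (aug B g) := by
  have h := lTensor_exact B (f := (LinearMap.ker g).subtype) (g := g)
    (LinearMap.exact_subtype_ker_map g) hg
  intro x
  have hinj : ∀ y : B ⊗[E] N, (LinearMap.id : N →ₗ[E] N).liftBaseChange B y = 0 → y = 0 := by
    intro y hy
    obtain ⟨n, rfl⟩ : ∃ n : N, (1 : B) ⊗ₜ[E] n = y := by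
      clear hy
      induction y with
      | zero => exact ⟨0, by simp⟩
      | add y z hy hz =>
        obtain ⟨m, rfl⟩ := hy
        obtain ⟨n, rfl⟩ := hz
        exact ⟨m + n, TensorProduct.tmul_add _ _ _⟩
      | tmul b n =>
        obtain ⟨e, rfl⟩ := hB b
        exact ⟨e • n, by rw [← TensorProduct.smul_tmul, Algebra.smul_def, mul_one]⟩
    have hn : n = 0 := by simpa using hy
    rw [hn, TensorProduct.tmul_zero]
  have hfac : ∀ x : B ⊗[E] F,
      aug B g x = (LinearMap.id : N →ₗ[E] N).liftBaseChange B (g.lTensor B x) := by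
    intro x
    induction x with
    | zero => simp
    | add y z hy hz => simp only [map_add, hy, hz]
    | tmul b n => simp [aug]
  have hx : aug B g x = 0 ↔ g.lTensor B x = 0 :=
    ⟨fun h0 => hinj _ (by rw [← hfac, h0]), fun h0 => by rw [hfac, h0, map_zero]⟩
  rw [hx, h x]
  rfl

/-- The exact sequence `0 → Tor₁^E(B, N) → B ⊗_E K → B ⊗_E F → N → 0`. -/
noncomputable def theta (hB : Function.Surjective (algebraMap E B)) (g : F →ₗ[E] N)
    (hg : Function.Surjective g) :
    TwoExt.{v, w, max v b, max v b, max v b} B N (Tor1 B g) where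
  T₁ := B ⊗[E] (LinearMap.ker g)
  T₀ := B ⊗[E] F
  ι := (Tor1 B g).subtype
  d := incl B g
  ε := aug B g
  ι_injective := Subtype.val_injective
  exact₁ := LinearMap.exact_subtype_ker_map _
  exact₀ := exact_incl_aug hB g hg
  ε_surjective := fun n => by
    obtain ⟨x, rfl⟩ := hg n
    exact ⟨1 ⊗ₜ x, by simp [aug_tmul]⟩

/-- The connecting homomorphism `∂ : Tor₁^E(B, N) → B ⊗_E N = N` of the exact sequence
`0 → B → E → B → 0`, given by the snake lemma for
```
    B ⊗ K → E ⊗ K → B ⊗ K → 0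
      ↓       ↓       ↓
0 → B ⊗ F → E ⊗ F → B ⊗ F
```
whose vertical maps have kernel `Tor₁^E(B, N)` on the right and cokernel `B ⊗_E N = N` on the
left. -/
noncomputable def connectingE (hB : Function.Surjective (algebraMap E B)) (i : B →ₗ[E] E)
    (hi : Function.Injective i) (hex : Function.Exact i (Algebra.linearMap E B))
    [Module.Projective E F] (g : F →ₗ[E] N) (hg : Function.Surjective g) :
    Tor1 B g →ₗ[E] N :=
  SnakeLemma.δ' (K₃ := Tor1 B g) (C₁ := N)
    (i₁ := (LinearMap.ker g).subtype.lTensor B)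
    (i₂ := (LinearMap.ker g).subtype.lTensor E)
    (i₃ := (LinearMap.ker g).subtype.lTensor B)
    (f₁ := i.rTensor (LinearMap.ker g))
    (f₂ := (Algebra.linearMap E B).rTensor (LinearMap.ker g))
    (hf := rTensor_exact _ hex hB)
    (g₁ := i.rTensor F) (g₂ := (Algebra.linearMap E B).rTensor F)
    (hg := rTensor_exact _ hex hB)
    (h₁ := by rw [LinearMap.rTensor_comp_lTensor, LinearMap.lTensor_comp_rTensor])
    (h₂ := by rw [LinearMap.rTensor_comp_lTensor, LinearMap.lTensor_comp_rTensor])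
    (ι₃ := (Tor1 B g).subtype.restrictScalars E)
    (hι₃ := LinearMap.exact_subtype_ker_map (incl B g))
    (π₁ := (aug B g).restrictScalars E)
    (hπ₁ := exact_incl_aug hB g hg)
    (hf₂ := LinearMap.rTensor_surjective _ hB)
    (hg₁ := Module.Flat.rTensor_preserves_injective_linearMap i hi)

/-- The connecting homomorphism `∂`, as a `B`-linear map. -/
noncomputable def connecting (hB : Function.Surjective (algebraMap E B)) (i : B →ₗ[E] E)
    (hi : Function.Injective i) (hex : Function.Exact i (Algebra.linearMap E B))
    [Module.Projective E F] (g : F →ₗ[E] N) (hg : Function.Surjective g) :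
    Tor1 B g →ₗ[B] N :=
  (connectingE hB i hi hex g hg).extendScalarsOfSurjective hB

theorem connecting_eq (hB : Function.Surjective (algebraMap E B)) (i : B →ₗ[E] E)
    (hi : Function.Injective i) (hex : Function.Exact i (Algebra.linearMap E B))
    [Module.Projective E F] (g : F →ₗ[E] N) (hg : Function.Surjective g)
    (z : Tor1 B g) (y : E ⊗[E] (LinearMap.ker g))
    (hy : (Algebra.linearMap E B).rTensor (LinearMap.ker g) y = z.1)
    (x : B ⊗[E] F) (hx : i.rTensor F x = (LinearMap.ker g).subtype.lTensor E y) :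
    connecting hB i hi hex g hg z = aug B g x := by
  change connectingE hB i hi hex g hg z = (aug B g).restrictScalars E x
  unfold connectingE
  exact SnakeLemma.δ'_eq (hy := hy) (hz := hx) ..

/-- The 2-extension `∂_*(0 → Tor₁^E(B, N) → B ⊗_E K → B ⊗_E F → N → 0)` of `N` by `N`. -/
noncomputable def ext (hB : Function.Surjective (algebraMap E B)) (i : B →ₗ[E] E)
    (hi : Function.Injective i) (hex : Function.Exact i (Algebra.linearMap E B))
    [Module.Projective E F] (g : F →ₗ[E] N) (hg : Function.Surjective g) :
    TwoExt.{v, w, w, max v b, max w v b} B N N :=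
  (theta hB g hg).pushforward (connecting hB i hi hex g hg)

end Presentation

end Psi

namespace Psi

section Functoriality

variable {E : Type a} {B : Type v} {N : Type w} {F : Type b} [CommRing E] [CommRing B] [Algebra E B]
  [AddCommGroup N] [Module E N] [AddCommGroup F] [Module E F]

theorem exists_one_tmul (hB : Function.Surjective (algebraMap E B)) (z : B ⊗[E] F) :
    ∃ x : F, (1 : B) ⊗ₜ[E] x = z := by
  induction z with
  | zero => exact ⟨0, by simp⟩
  | add y z hy hz =>
    obtain ⟨m, rfl⟩ := hy
    obtain ⟨n, rfl⟩ := hz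
    exact ⟨m + n, TensorProduct.tmul_add _ _ _⟩
  | tmul b n =>
    obtain ⟨e, rfl⟩ := hB b
    exact ⟨e • n, by rw [← TensorProduct.smul_tmul, Algebra.smul_def, mul_one]⟩

theorem exists_lift (hB : Function.Surjective (algebraMap E B)) (i : B →ₗ[E] E)
    (hex : Function.Exact i (Algebra.linearMap E B)) (g : F →ₗ[E] N) (z : Tor1 B g) :
    ∃ (y : LinearMap.ker g) (x : B ⊗[E] F), (1 : B) ⊗ₜ[E] y = z.1 ∧
      TensorProduct.lid E F (i.rTensor F x) = y.1 := by
  obtain ⟨y, hy⟩ := exists_one_tmul hB z.1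
  have h : (Algebra.linearMap E B).rTensor F (1 ⊗ₜ y.1) = 0 := by
    have hz : incl B g z.1 = 0 := z.2
    rw [← hy] at hz
    simpa [incl] using hz
  obtain ⟨x, hx⟩ := (rTensor_exact F hex hB _).1 h
  exact ⟨y, x, hy, by rw [hx]; simp⟩

variable [Module B N] [IsScalarTower E B N]

theorem connecting_eq_of_lid (hB : Function.Surjective (algebraMap E B)) (i : B →ₗ[E] E)
    (hi : Function.Injective i) (hex : Function.Exact i (Algebra.linearMap E B))
    [Module.Projective E F] (g : F →ₗ[E] N) (hg : Function.Surjective g)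
    (z : Tor1 B g) (y : LinearMap.ker g) (hy : (1 : B) ⊗ₜ[E] y = z.1)
    (x : B ⊗[E] F) (hx : TensorProduct.lid E F (i.rTensor F x) = y.1) :
    connecting hB i hi hex g hg z = aug B g x := by
  refine connecting_eq hB i hi hex g hg z (1 ⊗ₜ y) (by simp [← hy]) x ?_
  apply (TensorProduct.lid E F).injective
  rw [hx]
  simp

variable {E' : Type a} {F' : Type b} [CommRing E'] [Algebra E' B] [Algebra E E']
  [IsScalarTower E E' B] [Module E' N] [IsScalarTower E' B N]
  [AddCommGroup F'] [Module E' F'] [Module E F'] [IsScalarTower E E' F']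

/-- The map `B ⊗_E F → B ⊗_{E'} F'` induced by an `E`-linear map `F → F'`. -/
noncomputable def bmap (B : Type v) [CommRing B] [Algebra E B] [Algebra E' B]
    [IsScalarTower E E' B] (φ : F →ₗ[E] F') : B ⊗[E] F →ₗ[B] B ⊗[E'] F' :=
  LinearMap.liftBaseChange B
    (({ toFun := fun x => (1 : B) ⊗ₜ[E'] x
        map_add' := fun x y => TensorProduct.tmul_add _ _ _
        map_smul' := fun r x => by
          rw [RingHom.id_apply, ← algebraMap_smul E' r x, ← TensorProduct.smul_tmul,
            TensorProduct.smul_tmul', algebraMap_smul] } : F' →ₗ[E] B ⊗[E'] F') ∘ₗ φ)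

theorem bmap_tmul (φ : F →ₗ[E] F') (b : B) (x : F) :
    bmap B φ (b ⊗ₜ[E] x) = b ⊗ₜ[E'] φ x := by
  simp [bmap, TensorProduct.smul_tmul']

theorem directRel_ext (hB : Function.Surjective (algebraMap E B)) (i : B →ₗ[E] E)
    (hi : Function.Injective i) (hex : Function.Exact i (Algebra.linearMap E B))
    [Module.Projective E F] (g : F →ₗ[E] N) (hg : Function.Surjective g)
    (hB' : Function.Surjective (algebraMap E' B)) (i' : B →ₗ[E'] E')
    (hi' : Function.Injective i') (hex' : Function.Exact i' (Algebra.linearMap E' B))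
    [Module.Projective E' F'] (g' : F' →ₗ[E'] N) (hg' : Function.Surjective g')
    (hii : ∀ b, algebraMap E E' (i b) = i' b)
    (φ : F →ₗ[E] F') (hφ : ∀ x, g' (φ x) = g x) :
    TwoExt.DirectRel (ext hB i hi hex g hg) (ext hB' i' hi' hex' g' hg') := by
  let φK : LinearMap.ker g →ₗ[E] LinearMap.ker g' :=
    { toFun := fun x => ⟨φ x.1, by
        rw [LinearMap.mem_ker, hφ]
        exact x.2⟩
      map_add' := fun x y => Subtype.ext (map_add φ _ _)
      map_smul' := fun r x => Subtype.ext (map_smul φ _ _) }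
  have hsq : ∀ z, incl B g' (bmap B φK z) = bmap B φ (incl B g z) := by
    intro z
    induction z with
    | zero => simp
    | add y z hy hz => simp only [map_add, hy, hz]
    | tmul b n =>
      rw [bmap_tmul]
      simp [incl, bmap_tmul, φK]
  have haug : ∀ z, aug B g' (bmap B φ z) = aug B g z := by
    intro z
    induction z with
    | zero => simp
    | add y z hy hz => simp only [map_add, hy, hz]
    | tmul b n => rw [bmap_tmul, aug_tmul, aug_tmul, hφ]
  have hlid : ∀ x : B ⊗[E] F, TensorProduct.lid E' F' (i'.rTensor F' (bmap B φ x)) =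
      φ (TensorProduct.lid E F (i.rTensor F x)) := by
    intro z
    induction z with
    | zero => simp
    | add y z hy hz => simp only [map_add, hy, hz]
    | tmul b n =>
      rw [bmap_tmul]
      simp [← hii]
  let f : Tor1 B g →ₗ[B] Tor1 B g' :=
    LinearMap.codRestrict _ (bmap B φK ∘ₗ (Tor1 B g).subtype) (fun z => by
      rw [LinearMap.mem_ker, LinearMap.comp_apply, hsq]
      exact (congrArg (bmap B φ) z.2).trans (map_zero _))
  refine TwoExt.directRel_pushforward (theta hB g hg) (theta hB' g' hg') f (bmap B φK)
    (bmap B φ) (fun _ => rfl) hsq haug _ _ 0 ?_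
  intro z
  obtain ⟨y, x, hy, hx⟩ := exists_lift hB i hex g z
  rw [connecting_eq_of_lid hB i hi hex g hg z y hy x hx,
    connecting_eq_of_lid hB' i' hi' hex' g' hg' (f z) (φK y) ?_ (bmap B φ x) ?_, haug]
  · simp
  · change _ = bmap B φK z.1
    rw [← hy, bmap_tmul]
  · rw [hlid, hx]
    rfl

end Functoriality

end Psi

namespace InfExt

variable {k : Type u} {B : Type v} [CommRing k] [CommRing B] [Algebra k B]

/-- The map `i : B → E` as an `E`-linear map. -/
def iE (ξ : InfExt.{u, v, v} k B B) : B →ₗ[ξ.E] ξ.E where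
  toFun := ξ.i
  map_add' := map_add ξ.i
  map_smul' := fun e m => (ξ.mul_i e m).symm

/-- The 2-extension `∂_*(0 → Tor₁^E(B, N) → B ⊗_E K → B ⊗_E F → N → 0)` attached to an infinitesimal
extension `0 → B → E → B → 0`, a `B`-module `N` (regarded as an `E`-module via `p : E → B`)
and a projective presentation `0 → K → F → N → 0` of `N` over `E`. -/
noncomputable def psiExt (ξ : InfExt.{u, v, v} k B B) {N : Type w} [AddCommGroup N] [Module B N]
    [Module ξ.E N] [IsScalarTower ξ.E B N] {F : Type (max v w)} [AddCommGroup F] [Module ξ.E F]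
    [Module.Projective ξ.E F] (g : F →ₗ[ξ.E] N) (hg : Function.Surjective g) :
    TwoExt.{v, w, w, max v w, max v w} B N N :=
  Psi.ext ξ.p_surjective ξ.iE ξ.i_injective ξ.exact g hg

theorem directRel_psiExt (ξ ξ' : InfExt.{u, v, v} k B B) (h : ξ.Equivalent ξ')
    {N : Type w} [AddCommGroup N] [Module B N]
    [Module ξ.E N] [IsScalarTower ξ.E B N] {F : Type (max v w)} [AddCommGroup F] [Module ξ.E F]
    [Module.Projective ξ.E F] (g : F →ₗ[ξ.E] N) (hg : Function.Surjective g)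
    [Module ξ'.E N] [IsScalarTower ξ'.E B N] {F' : Type (max v w)} [AddCommGroup F']
    [Module ξ'.E F'] [Module.Projective ξ'.E F'] (g' : F' →ₗ[ξ'.E] N)
    (hg' : Function.Surjective g') :
    TwoExt.DirectRel (ξ.psiExt g hg) (ξ'.psiExt g' hg') := by
  obtain ⟨α, hα, hp⟩ := h
  let : Algebra ξ.E ξ'.E := α.toRingHom.toAlgebra
  let : Module ξ.E F' := Module.compHom F' α.toRingHom
  have : IsScalarTower ξ.E ξ'.E F' := ⟨fun x y z => mul_smul (α x) y z⟩
  have : IsScalarTower ξ.E ξ'.E B := IsScalarTower.of_algebraMap_eq fun e => (hp e).symm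
  have hs : ∀ (e : ξ.E) (n : N), e • n = α e • n := fun e n => by
    rw [← algebraMap_smul B e n, ← algebraMap_smul B (α e) n, algebraMap_eq, algebraMap_eq, hp]
  let g'' : F' →ₗ[ξ.E] N :=
    { toFun := g'
      map_add' := map_add g'
      map_smul' := fun e x => by
        rw [RingHom.id_apply, hs]
        exact map_smul g' (α e) x }
  obtain ⟨φ, hφ⟩ := Module.projective_lifting_property g'' g hg'
  exact Psi.directRel_ext _ _ _ _ g hg _ _ _ _ g' hg' hα φ (fun x => LinearMap.congr_fun hφ x)

end InfExt

/-- The `E`-module structure on a `B`-module given by `p : E → B`. -/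
@[reducible] def InfExt.moduleRes {k : Type u} {B : Type v} [CommRing k] [CommRing B] [Algebra k B]
    (ξ : InfExt.{u, v, v} k B B) (N : Type w) [AddCommGroup N] [Module B N] : Module ξ.E N :=
  Module.compHom N ξ.p.toRingHom

theorem InfExt.isScalarTower_moduleRes {k : Type u} {B : Type v} [CommRing k] [CommRing B]
    [Algebra k B] (ξ : InfExt.{u, v, v} k B B) (N : Type w) [AddCommGroup N] [Module B N] :
    letI := ξ.moduleRes N
    IsScalarTower ξ.E B N :=
  let := ξ.moduleRes N
  ⟨fun e b n => mul_smul (ξ.p e) b n⟩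

/-- The 2-extension `psiExt` computed with the free `E`-module on the set `N`. -/
noncomputable def InfExt.psiFree {k : Type u} {B : Type v} [CommRing k] [CommRing B]
    [Algebra k B] (ξ : InfExt.{u, v, v} k B B) (N : Type w) [AddCommGroup N] [Module B N] :
    TwoExt.{v, w, w, max v w, max v w} B N N :=
  letI := ξ.moduleRes N
  haveI := ξ.isScalarTower_moduleRes N
  ξ.psiExt (Finsupp.linearCombination ξ.E (id : N → N))
    (Finsupp.linearCombination_surjective ξ.E Function.surjective_id)

theorem InfExt.directRel_psiFree {k : Type u} {B : Type v} [CommRing k] [CommRing B]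
    [Algebra k B] (ξ ξ' : InfExt.{u, v, v} k B B) (h : ξ.Equivalent ξ')
    {N : Type w} [AddCommGroup N] [Module B N] [Module ξ'.E N] [IsScalarTower ξ'.E B N]
    {F' : Type (max v w)} [AddCommGroup F'] [Module ξ'.E F'] [Module.Projective ξ'.E F']
    (g' : F' →ₗ[ξ'.E] N) (hg' : Function.Surjective g') :
    TwoExt.DirectRel (ξ.psiFree N) (ξ'.psiExt g' hg') := by
  let := ξ.moduleRes N
  have := ξ.isScalarTower_moduleRes N
  exact InfExt.directRel_psiExt ξ ξ' h _ _ g' hg'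

/-- The map `ψ : Exal_k(B, B) → Ex²_B(N, N)`. It is computed here with the free `E`-module on the
set `N`; any other projective presentation gives the same class, see `psi_mk`. -/
noncomputable def psi (k : Type u) (B : Type v) [CommRing k] [CommRing B] [Algebra k B]
    (N : Type w) [AddCommGroup N] [Module B N] :
    Exal k B B → Ex2.{v, w, w, max v w} B N N :=
  Quot.lift (fun ξ => Ex2.mk (ξ.psiFree N)) (fun ξ ξ' h => by
    let := ξ'.moduleRes N
    have := ξ'.isScalarTower_moduleRes N
    exact Quot.sound (InfExt.directRel_psiFree ξ ξ' h _ _))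

/-- `ψ([ξ])` can be computed with any projective presentation of `N` over `E`. -/
theorem psi_mk {k : Type u} {B : Type v} [CommRing k] [CommRing B] [Algebra k B]
    {N : Type w} [AddCommGroup N] [Module B N] (ξ : InfExt.{u, v, v} k B B)
    [Module ξ.E N] [IsScalarTower ξ.E B N] {F : Type (max v w)} [AddCommGroup F] [Module ξ.E F]
    [Module.Projective ξ.E F] (g : F →ₗ[ξ.E] N) (hg : Function.Surjective g) :
    psi k B N (Exal.mk ξ) = Ex2.mk (ξ.psiExt g hg) :=
  Quot.sound (InfExt.directRel_psiFree ξ ξ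
    ⟨AlgHom.id k ξ.E, fun _ => rfl, fun _ => rfl⟩ g hg)

namespace Hochschild

section Bar

variable (k : Type u) (B : Type v) [CommRing k] [CommRing B] [Algebra k B]

/-- The ring `B`, considered as a module over `B ⊗ B` via the multiplication `B ⊗ B → B`. -/
def Diag (k : Type u) (B : Type v) [CommRing k] [CommRing B] [Algebra k B] : Type v := B

instance : AddCommGroup (Diag k B) := inferInstanceAs (AddCommGroup B)

noncomputable instance : Module (B ⊗[k] B) (Diag k B) :=
  Module.compHom B (Algebra.TensorProduct.lmul' k (S := B)).toRingHom

/-- The identity map `B → B`. -/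
def toB : Diag k B ≃+ B := AddEquiv.refl B

theorem toB_smul (t : B ⊗[k] B) (m : Diag k B) :
    toB k B (t • m) = Algebra.TensorProduct.lmul' k t * toB k B m := rfl

/-- The augmentation `d₀ : B ⊗ B → B`, `b ⊗ b' ↦ b b'`. -/
noncomputable def d₀ : B ⊗[k] B →ₗ[B ⊗[k] B] Diag k B where
  toFun x := (toB k B).symm (Algebra.TensorProduct.lmul' k x)
  map_add' x y := by rw [map_add, map_add]
  map_smul' t x := (toB k B).injective (by
    rw [RingHom.id_apply, toB_smul, AddEquiv.apply_symm_apply, AddEquiv.apply_symm_apply,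
      smul_eq_mul, map_mul])

theorem toB_d₀ (x : B ⊗[k] B) : toB k B (d₀ k B x) = Algebra.TensorProduct.lmul' k x := rfl

/-- The bar differential `d₁ : B ⊗ B ⊗ B → B ⊗ B`, `b₀ ⊗ b₁ ⊗ b₂ ↦ b₀ b₁ ⊗ b₂ - b₀ ⊗ b₁ b₂`.
The `B ⊗ B`-module `B ⊗ B ⊗ B` (on which `b ⊗ b'` multiplies `b₀` by `b` and `b₂` by `b'`) is
written as `(B ⊗ B) ⊗ B`, the element `b₀ ⊗ b₁ ⊗ b₂` being written as `(b₀ ⊗ b₂) ⊗ b₁`. -/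
noncomputable def d₁ : (B ⊗[k] B) ⊗[k] B →ₗ[B ⊗[k] B] B ⊗[k] B :=
  LinearMap.liftBaseChange (B ⊗[k] B)
    ((TensorProduct.mk k B B).flip 1 - TensorProduct.mk k B B 1)

theorem d₁_tmul (b₀ b₁ b₂ : B) :
    d₁ k B ((b₀ ⊗ₜ b₂) ⊗ₜ b₁) = (b₀ * b₁) ⊗ₜ b₂ - b₀ ⊗ₜ (b₁ * b₂) := by
  simp [d₁, mul_comm]

theorem exact_d₁_d₀ : Function.Exact (d₁ k B) (d₀ k B) := by
  let h : B ⊗[k] B →ₗ[k] (B ⊗[k] B) ⊗[k] B :=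
    TensorProduct.lift (LinearMap.mk₂ k (fun b b' => (1 ⊗ₜ[k] b') ⊗ₜ[k] b)
      (fun x y z => TensorProduct.tmul_add _ _ _) (fun r x y => TensorProduct.tmul_smul _ _ _)
      (fun x y z => by rw [TensorProduct.tmul_add, TensorProduct.add_tmul])
      (fun r x y => by rw [TensorProduct.tmul_smul, ← TensorProduct.smul_tmul']))
  have hh : ∀ x : B ⊗[k] B, x = d₁ k B (h x) + 1 ⊗ₜ Algebra.TensorProduct.lmul' k x := by
    intro x
    induction x with
    | zero => simp
    | add y z hy hz =>
      simp only [map_add, TensorProduct.tmul_add]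
      rw [add_add_add_comm, ← hy, ← hz]
    | tmul b b' =>
      have : h (b ⊗ₜ b') = (1 ⊗ₜ b') ⊗ₜ b := by simp [h]
      rw [this, d₁_tmul]
      simp
  have hd : ∀ y, Algebra.TensorProduct.lmul' k (d₁ k B y) = 0 := by
    intro y
    induction y with
    | zero => simp
    | add y z hy hz => simp only [map_add, hy, hz, add_zero]
    | tmul x b =>
      induction x with
      | zero => simp
      | add y z hy hz => simp only [TensorProduct.add_tmul, map_add, hy, hz, add_zero]
      | tmul b₀ b₂ =>
        rw [d₁_tmul, map_sub]
        simp [mul_assoc]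
  intro x
  constructor
  · intro hx
    have hx : Algebra.TensorProduct.lmul' k x = 0 := hx
    refine ⟨h x, ?_⟩
    conv_rhs => rw [hh x]
    rw [hx]
    simp
  · rintro ⟨y, rfl⟩
    exact hd y

/-- The 2-extension `0 → ker d₁ → B ⊗ B ⊗ B → B ⊗ B → B → 0` of `B ⊗ B`-modules, a truncation of
the bar resolution. -/
noncomputable def barExt : TwoExt.{v, v, v, v, v} (B ⊗[k] B) (Diag k B) (LinearMap.ker (d₁ k B)) where
  T₁ := (B ⊗[k] B) ⊗[k] B
  T₀ := B ⊗[k] B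
  ι := (LinearMap.ker (d₁ k B)).subtype
  d := d₁ k B
  ε := d₀ k B
  ι_injective := Subtype.val_injective
  exact₁ := LinearMap.exact_subtype_ker_map _
  exact₀ := exact_d₁_d₀ k B
  ε_surjective := fun b => ⟨toB k B b ⊗ₜ 1, (toB k B).injective (by simp [toB_d₀])⟩

variable {k B}

/-- The `k`-linear map `B ⊗ B ⊗ B → B`, `b₀ ⊗ b₁ ⊗ b₂ ↦ f(b₀, b₁) b₂`
(with `b₀ ⊗ b₁ ⊗ b₂` written as `(b₀ ⊗ b₂) ⊗ b₁`). -/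
noncomputable def betaMap (f : B →ₗ[k] B →ₗ[k] B) : (B ⊗[k] B) ⊗[k] B →ₗ[k] B :=
  TensorProduct.lift (TensorProduct.lift
    (LinearMap.mk₂ k (fun b₀ b₂ => LinearMap.mulRight k b₂ ∘ₗ f b₀)
      (fun x y z => by ext; simp [add_mul]) (fun r x z => by ext; simp)
      (fun x y z => by ext; simp [mul_add]) (fun r x z => by ext; simp)))

theorem betaMap_tmul (f : B →ₗ[k] B →ₗ[k] B) (b₀ b₁ b₂ : B) :
    betaMap f ((b₀ ⊗ₜ b₂) ⊗ₜ b₁) = f b₀ b₁ * b₂ := by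
  simp [betaMap]

/-- The `k`-linear map `B ⊗ B → B`, `b ⊗ b' ↦ h(b) b'`. -/
noncomputable def auxMap (h : B →ₗ[k] B) : B ⊗[k] B →ₗ[k] B :=
  TensorProduct.lift ((LinearMap.mul k B) ∘ₗ h)

theorem auxMap_tmul (h : B →ₗ[k] B) (b b' : B) : auxMap h (b ⊗ₜ b') = h b * b' := by
  simp [auxMap]

theorem betaMap_smul (f : B →ₗ[k] B →ₗ[k] B)
    (hf : ∀ x y z, x * f y z - f (x * y) z + f x (y * z) - f x y * z = 0)
    (c c' : B) (x : (B ⊗[k] B) ⊗[k] B) :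
    betaMap f ((c ⊗ₜ[k] c') • x) =
      c * c' * betaMap f x + c' * auxMap (f c) (d₁ k B x) := by
  induction x with
  | zero => simp
  | add y z hy hz =>
    simp only [smul_add, map_add, mul_add, hy, hz]
    ring
  | tmul x b₁ =>
    induction x with
    | zero => simp
    | add y z hy hz =>
      simp only [TensorProduct.add_tmul, smul_add, map_add, mul_add, hy, hz]
      ring
    | tmul b₀ b₂ =>
      rw [TensorProduct.smul_tmul', smul_eq_mul, Algebra.TensorProduct.tmul_mul_tmul,
        betaMap_tmul, betaMap_tmul, d₁_tmul, map_sub, auxMap_tmul, auxMap_tmul]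
      linear_combination (-(b₂ * c')) * hf c b₀ b₁

/-- For a 2-cocycle `f`, the restriction `β : ker d₁ → B` of the map
`b₀ ⊗ b₁ ⊗ b₂ ↦ f(b₀, b₁) b₂`; it is `B ⊗ B`-linear. -/
noncomputable def beta (f : B →ₗ[k] B →ₗ[k] B)
    (hf : ∀ x y z, x * f y z - f (x * y) z + f x (y * z) - f x y * z = 0) :
    LinearMap.ker (d₁ k B) →ₗ[B ⊗[k] B] Diag k B where
  toFun x := (toB k B).symm (betaMap f x.1)
  map_add' x y := by rw [Submodule.coe_add, map_add, map_add]
  map_smul' t x := (toB k B).injective (by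
    rw [RingHom.id_apply, toB_smul, AddEquiv.apply_symm_apply, AddEquiv.apply_symm_apply,
      Submodule.coe_smul]
    induction t with
    | zero => simp
    | add y z hy hz => rw [add_smul, map_add, hy, hz, map_add, add_mul]
    | tmul c c' =>
      rw [betaMap_smul f hf, (show d₁ k B x.1 = 0 from x.2)]
      simp)

end Bar

end Hochschild

/-- The Hochschild cohomology `HH²(B|k) = Ext²_{B ⊗ B}(B, B)`, as the set of classes of
2-extensions of the `B ⊗ B`-module `B` by itself. -/
abbrev HH2 (k : Type u) (B : Type v) [CommRing k] [CommRing B] [Algebra k B] : Type (v + 1) :=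
  Ex2.{v, v, v, v} (B ⊗[k] B) (Hochschild.Diag k B) (Hochschild.Diag k B)

namespace InfExt

section Cocycle

variable {k : Type u} {B : Type v} [CommRing k] [CommRing B] [Algebra k B]

theorem i_invFun (ξ : InfExt.{u, v, v} k B B) (e : ξ.E) (he : ξ.p e = 0) :
    ξ.i (Function.invFun ξ.i e) = e :=
  Function.invFun_eq ((ξ.exact e).1 he)

theorem p_cocycle (ξ : InfExt.{u, v, v} k B B) (σ : B →ₗ[k] ξ.E) (hσ : ∀ b, ξ.p (σ b) = b)
    (x y : B) : ξ.p (σ x * σ y - σ (x * y)) = 0 := by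
  simp [hσ]

/-- The Hochschild 2-cocycle `f(x, y) = i⁻¹(σ(x) σ(y) - σ(x y))` of an infinitesimal extension
`0 → B → E → B → 0` with a `k`-linear section `σ`. -/
noncomputable def cocycle (ξ : InfExt.{u, v, v} k B B) (σ : B →ₗ[k] ξ.E)
    (hσ : ∀ b, ξ.p (σ b) = b) : B →ₗ[k] B →ₗ[k] B :=
  LinearMap.mk₂ k (fun x y => Function.invFun ξ.i (σ x * σ y - σ (x * y)))
    (fun x x' y => ξ.i_injective (by
      rw [map_add ξ.i, i_invFun _ _ (ξ.p_cocycle σ hσ _ _), i_invFun _ _ (ξ.p_cocycle σ hσ _ _),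
        i_invFun _ _ (ξ.p_cocycle σ hσ _ _)]
      simp only [map_add, add_mul]
      ring))
    (fun r x y => ξ.i_injective (by
      rw [map_smul ξ.i, i_invFun _ _ (ξ.p_cocycle σ hσ _ _), i_invFun _ _ (ξ.p_cocycle σ hσ _ _)]
      simp only [map_smul, smul_mul_assoc, smul_sub]))
    (fun x y y' => ξ.i_injective (by
      rw [map_add ξ.i, i_invFun _ _ (ξ.p_cocycle σ hσ _ _), i_invFun _ _ (ξ.p_cocycle σ hσ _ _),
        i_invFun _ _ (ξ.p_cocycle σ hσ _ _)]
      simp only [map_add, mul_add]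
      ring))
    (fun r x y => ξ.i_injective (by
      rw [map_smul ξ.i, i_invFun _ _ (ξ.p_cocycle σ hσ _ _), i_invFun _ _ (ξ.p_cocycle σ hσ _ _)]
      simp only [map_smul, mul_smul_comm, smul_sub]))

theorem i_cocycle (ξ : InfExt.{u, v, v} k B B) (σ : B →ₗ[k] ξ.E) (hσ : ∀ b, ξ.p (σ b) = b)
    (x y : B) : ξ.i (ξ.cocycle σ hσ x y) = σ x * σ y - σ (x * y) :=
  ξ.i_invFun _ (ξ.p_cocycle σ hσ x y)

theorem i_mul (ξ : InfExt.{u, v, v} k B B) (σ : B →ₗ[k] ξ.E) (hσ : ∀ b, ξ.p (σ b) = b)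
    (x y : B) : ξ.i (x * y) = σ x * ξ.i y := by
  rw [ξ.mul_i, hσ, smul_eq_mul]

theorem cocycle_condition (ξ : InfExt.{u, v, v} k B B) (σ : B →ₗ[k] ξ.E)
    (hσ : ∀ b, ξ.p (σ b) = b) (x y z : B) :
    x * ξ.cocycle σ hσ y z - ξ.cocycle σ hσ (x * y) z + ξ.cocycle σ hσ x (y * z) -
      ξ.cocycle σ hσ x y * z = 0 := by
  apply ξ.i_injective
  rw [mul_comm (ξ.cocycle σ hσ x y) z]
  simp only [map_sub, map_add, map_zero, i_mul ξ σ hσ, i_cocycle]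
  rw [mul_assoc x y z]
  ring

/-- The 2-extension `0 → B → W → B ⊗ B → B → 0` of `B ⊗ B`-modules attached to an infinitesimal
extension with a `k`-linear section `σ`: the pushout of
`0 → ker d₁ → B ⊗ B ⊗ B → B ⊗ B → B → 0` along the map `β : ker d₁ → B` defined by the
cocycle of `σ`. -/
noncomputable def gammaExt (ξ : InfExt.{u, v, v} k B B) (σ : B →ₗ[k] ξ.E)
    (hσ : ∀ b, ξ.p (σ b) = b) :
    TwoExt.{v, v, v, v, v} (B ⊗[k] B) (Hochschild.Diag k B) (Hochschild.Diag k B) :=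
  (Hochschild.barExt k B).pushforward
    (Hochschild.beta (ξ.cocycle σ hσ) (ξ.cocycle_condition σ hσ))

theorem directRel_gammaExt (ξ ξ' : InfExt.{u, v, v} k B B) (h : ξ.Equivalent ξ')
    (σ : B →ₗ[k] ξ.E) (hσ : ∀ b, ξ.p (σ b) = b)
    (σ' : B →ₗ[k] ξ'.E) (hσ' : ∀ b, ξ'.p (σ' b) = b) :
    TwoExt.DirectRel (ξ.gammaExt σ hσ) (ξ'.gammaExt σ' hσ') := by
  obtain ⟨α, hα, hp⟩ := h
  have hk : ∀ b, ξ'.p (α (σ b) - σ' b) = 0 := fun b => by rw [map_sub, hp, hσ, hσ', sub_self]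
  let η : B →ₗ[k] B :=
    { toFun := fun b => Function.invFun ξ'.i (α (σ b) - σ' b)
      map_add' := fun x y => ξ'.i_injective (by
        rw [map_add ξ'.i, i_invFun _ _ (hk _), i_invFun _ _ (hk _), i_invFun _ _ (hk _)]
        simp only [map_add]
        ring)
      map_smul' := fun r x => ξ'.i_injective (by
        rw [map_smul ξ'.i, i_invFun _ _ (hk _), i_invFun _ _ (hk _)]
        simp only [map_smul, smul_sub, RingHom.id_apply]) }
  have hη : ∀ b, ξ'.i (η b) = α (σ b) - σ' b := fun b => i_invFun _ _ (hk b)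
  have hsq : ∀ x y, ξ'.i x * ξ'.i y = 0 := fun x y => by
    rw [ξ'.mul_i, ξ'.exact.apply_apply_eq_zero, zero_smul, map_zero]
  have hf : ∀ x y, ξ.cocycle σ hσ x y =
      ξ'.cocycle σ' hσ' x y + (x * η y + y * η x - η (x * y)) := fun x y => by
    apply ξ'.i_injective
    have h1 := hsq (η x) (η y)
    rw [← hα, i_cocycle]
    simp only [map_sub, map_add, map_mul, i_mul ξ' σ' hσ', i_cocycle, hη] at h1 ⊢
    linear_combination h1
  let H : (B ⊗[k] B) ⊗[k] B →ₗ[B ⊗[k] B] Hochschild.Diag k B :=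
    Hochschild.d₀ k B ∘ₗ LinearMap.liftBaseChange (B ⊗[k] B) (TensorProduct.mk k B B 1 ∘ₗ η)
  have hH : ∀ x, Hochschild.betaMap (ξ.cocycle σ hσ) x =
      Hochschild.betaMap (ξ'.cocycle σ' hσ') x + Hochschild.toB k B (H x) -
        Hochschild.auxMap η (Hochschild.d₁ k B x) := by
    intro x
    induction x with
    | zero => simp
    | add y z hy hz =>
      simp only [map_add, hy, hz]
      ring
    | tmul x b₁ =>
      induction x with
      | zero => simp
      | add y z hy hz =>
        simp only [TensorProduct.add_tmul, map_add, hy, hz]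
        ring
      | tmul b₀ b₂ =>
        have h2 : Hochschild.toB k B (H ((b₀ ⊗ₜ b₂) ⊗ₜ b₁)) = b₀ * b₂ * η b₁ := by
          simp [H, Hochschild.toB_d₀, mul_assoc]
        rw [Hochschild.betaMap_tmul, Hochschild.betaMap_tmul, Hochschild.d₁_tmul, map_sub,
          Hochschild.auxMap_tmul, Hochschild.auxMap_tmul, h2, hf]
        ring
  refine TwoExt.directRel_pushforward (Hochschild.barExt k B) (Hochschild.barExt k B)
    LinearMap.id LinearMap.id LinearMap.id (fun _ => rfl) (fun _ => rfl) (fun _ => rfl) _ _ H ?_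
  intro x
  have h3 := hH x.1
  rw [(show Hochschild.d₁ k B x.1 = 0 from x.2), map_zero, sub_zero] at h3
  exact h3

end Cocycle

theorem exists_section {k : Type u} {B : Type v} [Field k] [CommRing B] [Algebra k B]
    (ξ : InfExt.{u, v, v} k B B) : ∃ σ : B →ₗ[k] ξ.E, ∀ b, ξ.p (σ b) = b := by
  obtain ⟨σ, hσ⟩ := LinearMap.exists_rightInverse_of_surjective ξ.p.toLinearMap
    (LinearMap.range_eq_top.2 ξ.p_surjective)
  exact ⟨σ, fun b => LinearMap.congr_fun hσ b⟩

end InfExt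

/-- The canonical map `γ : Exal_k(B, B) → HH²(B|k)`, computed with some `k`-linear section; any other
section gives the same class, see `gamma_mk`. -/
noncomputable def gamma (k : Type u) (B : Type v) [Field k] [CommRing B] [Algebra k B] :
    Exal k B B → HH2 k B :=
  Quot.lift
    (fun ξ => Ex2.mk (ξ.gammaExt ξ.exists_section.choose ξ.exists_section.choose_spec))
    (fun ξ ξ' h => Quot.sound (InfExt.directRel_gammaExt ξ ξ' h _ _ _ _))

theorem gamma_mk {k : Type u} {B : Type v} [Field k] [CommRing B] [Algebra k B]
    (ξ : InfExt.{u, v, v} k B B) (σ : B →ₗ[k] ξ.E) (hσ : ∀ b, ξ.p (σ b) = b) :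
    gamma k B (Exal.mk ξ) = Ex2.mk (ξ.gammaExt σ hσ) :=
  Quot.sound (InfExt.directRel_gammaExt ξ ξ
    ⟨AlgHom.id k ξ.E, fun _ => rfl, fun _ => rfl⟩ _ _ _ _)

namespace Hochschild

/-- A `B ⊗ B`-module `T`, considered also as a `B`-module via `B → B ⊗ B`, `b ↦ 1 ⊗ b`. -/
def ViaRight (k : Type u) (B : Type v) [CommRing k] [CommRing B] [Algebra k B] (T : Type t) :
    Type t := T

section ViaRight

variable (k : Type u) (B : Type v) [CommRing k] [CommRing B] [Algebra k B]
  (T : Type t) [AddCommGroup T] [Module (B ⊗[k] B) T]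

instance : AddCommGroup (ViaRight k B T) := inferInstanceAs (AddCommGroup T)

instance : Module (B ⊗[k] B) (ViaRight k B T) := inferInstanceAs (Module (B ⊗[k] B) T)

noncomputable instance : Module B (ViaRight k B T) :=
  Module.compHom T (Algebra.TensorProduct.includeRight : B →ₐ[k] B ⊗[k] B).toRingHom

/-- The identity map `T → T`. -/
def toRight : T ≃+ ViaRight k B T := AddEquiv.refl T

variable {T}

theorem smul_toRight (b : B) (x : T) :
    b • toRight k B T x = toRight k B T ((1 ⊗ₜ[k] b : B ⊗[k] B) • x) := rfl

theorem env_smul_toRight (s : B ⊗[k] B) (x : T) :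
    s • toRight k B T x = toRight k B T (s • x) := rfl

instance : SMulCommClass B (B ⊗[k] B) (ViaRight k B T) where
  smul_comm b s x := by
    obtain ⟨x, rfl⟩ := (toRight k B T).surjective x
    rw [env_smul_toRight, smul_toRight, smul_toRight, env_smul_toRight, smul_comm]

variable {k B} {T' : Type t} [AddCommGroup T'] [Module (B ⊗[k] B) T']

/-- A `B ⊗ B`-linear map is linear for the right `B`-module structures. -/
noncomputable def rightMap (f : T →ₗ[B ⊗[k] B] T') : ViaRight k B T →ₗ[B] ViaRight k B T' where
  toFun := f
  map_add' := map_add f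
  map_smul' b x := map_smul f (1 ⊗ₜ[k] b : B ⊗[k] B) x

theorem rightMap_toRight (f : T →ₗ[B ⊗[k] B] T') (x : T) :
    rightMap f (toRight k B T x) = toRight k B T' (f x) := rfl

variable (k B)

instance : Module.Free B (ViaRight k B (Diag k B)) :=
  Module.Free.of_equiv
    ({ (toB k B).symm.trans (toRight k B (Diag k B)) with
      map_smul' := fun b c => by
        apply (toB k B).injective
        change _ = toB k B ((1 ⊗ₜ[k] b : B ⊗[k] B) • (toB k B).symm c)
        rw [toB_smul]
        change b * c = _ * c
        simp } : B ≃ₗ[B] ViaRight k B (Diag k B))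

theorem free_viaRight [Module.Free k B] [Module.Free (B ⊗[k] B) T] :
    Module.Free B (ViaRight k B T) := by
  let I := Module.Free.ChooseBasisIndex (B ⊗[k] B) T
  let e : T ≃ₗ[B ⊗[k] B] (I →₀ B ⊗[k] B) := (Module.Free.chooseBasis (B ⊗[k] B) T).repr
  let c : B ⊗[k] B ≃+ B ⊗[k] B := (TensorProduct.comm k B B).toAddEquiv
  have hc : ∀ (b : B) (x : B ⊗[k] B), c ((1 ⊗ₜ b) * x) = b • c x := by
    intro b x
    induction x with
    | zero => simp
    | add y z hy hz => simp only [mul_add, map_add, hy, hz, smul_add]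
    | tmul y z => simp [c, TensorProduct.smul_tmul']
  let e' : ViaRight k B T ≃ₗ[B] (I →₀ B ⊗[k] B) :=
    { ((toRight k B T).symm.trans e.toAddEquiv).trans (Finsupp.mapRange.addEquiv c) with
      map_smul' := fun b x => by
        obtain ⟨x, rfl⟩ := (toRight k B T).surjective x
        rw [smul_toRight]
        ext j
        change c (e ((1 ⊗ₜ[k] b : B ⊗[k] B) • x) j) = b • c (e x j)
        rw [map_smul, Finsupp.smul_apply, smul_eq_mul, hc] }
  exact Module.Free.of_equiv e'.symm

end ViaRight

section RTensor

/-- For a `B ⊗ B`-module `T` and a `B`-module `N`, the tensor product `T ⊗_B N` formed with the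
`B`-module structure of `T` given by `b ↦ 1 ⊗ b`. It is considered as a `B`-module through the
other structure of `T`, the one given by `b ↦ b ⊗ 1`. -/
def RTensor (k : Type u) (B : Type v) [CommRing k] [CommRing B] [Algebra k B]
    (T : Type t) [AddCommGroup T] [Module (B ⊗[k] B) T] (N : Type w) [AddCommGroup N] [Module B N] :
    Type (max t w) :=
  ViaRight k B T ⊗[B] N

variable (k : Type u) (B : Type v) [CommRing k] [CommRing B] [Algebra k B]
  (T : Type t) [AddCommGroup T] [Module (B ⊗[k] B) T] (N : Type w) [AddCommGroup N] [Module B N]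

noncomputable instance : AddCommGroup (RTensor k B T N) :=
  inferInstanceAs (AddCommGroup (ViaRight k B T ⊗[B] N))

noncomputable instance : Module B (RTensor k B T N) :=
  Module.compHom (ViaRight k B T ⊗[B] N)
    (Algebra.TensorProduct.includeLeft : B →ₐ[k] B ⊗[k] B).toRingHom

/-- The identity map `T ⊗_B N → T ⊗_B N`. -/
noncomputable def toRTensor : ViaRight k B T ⊗[B] N ≃+ RTensor k B T N := AddEquiv.refl _

variable {T N}

/-- The element `x ⊗ n` of `T ⊗_B N`. -/
noncomputable def rtmul (x : T) (n : N) : RTensor k B T N := toRTensor k B T N (toRight k B T x ⊗ₜ n)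

theorem smul_rtmul (b : B) (x : T) (n : N) :
    b • rtmul k B x n = rtmul k B ((b ⊗ₜ[k] 1 : B ⊗[k] B) • x) n := rfl

theorem rtmul_smul (b : B) (x : T) (n : N) :
    rtmul k B x (b • n) = rtmul k B ((1 ⊗ₜ[k] b : B ⊗[k] B) • x) n := by
  unfold rtmul
  rw [← smul_toRight, TensorProduct.smul_tmul]

theorem rtmul_induction {p : RTensor k B T N → Prop} (x : RTensor k B T N)
    (zero : p 0) (tmul : ∀ x n, p (rtmul k B x n)) (sum : ∀ x y, p x → p y → p (x + y)) : p x :=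
  TensorProduct.induction_on (motive := p) x zero tmul sum

variable {k B} {T' : Type t} [AddCommGroup T'] [Module (B ⊗[k] B) T']

variable (N) in
/-- The map `f ⊗ 1 : T ⊗_B N → T' ⊗_B N`. -/
noncomputable def rmap (f : T →ₗ[B ⊗[k] B] T') : RTensor k B T N →ₗ[B] RTensor k B T' N where
  toFun x := toRTensor k B T' N ((rightMap f).rTensor N ((toRTensor k B T N).symm x))
  map_add' x y := by simp only [map_add]
  map_smul' b x := by
    induction x using rtmul_induction with
    | zero => simp only [smul_zero, map_zero]
    | sum x y hx hy => simp only [smul_add, map_add, hx, hy]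
    | tmul x n =>
      change toRTensor k B T' N (toRight k B T' (f ((b ⊗ₜ[k] 1 : B ⊗[k] B) • x)) ⊗ₜ n) =
        toRTensor k B T' N (toRight k B T' ((b ⊗ₜ[k] 1 : B ⊗[k] B) • f x) ⊗ₜ n)
      rw [map_smul]

theorem rmap_rtmul (f : T →ₗ[B ⊗[k] B] T') (x : T) (n : N) :
    rmap N f (rtmul k B x n) = rtmul k B (f x) n := rfl

variable (k B N)

/-- The isomorphism `B ⊗_B N ≅ N`. -/
noncomputable def unitEquiv : RTensor k B (Diag k B) N ≃ₗ[B] N :=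
  let F : ViaRight k B (Diag k B) ⊗[B] N →+ N :=
    (TensorProduct.lift ({
      toFun := fun x => LinearMap.lsmul B N (toB k B ((toRight k B _).symm x))
      map_add' := fun x y => by simp only [map_add]
      map_smul' := fun b x => by
        obtain ⟨x, rfl⟩ := (toRight k B _).surjective x
        ext n
        rw [smul_toRight, AddEquiv.symm_apply_apply, toB_smul]
        simp [mul_smul] } : ViaRight k B (Diag k B) →ₗ[B] N →ₗ[B] N)).toAddMonoidHom
  have hF : ∀ x n, F ((toRTensor k B _ N).symm (rtmul k B x n)) = toB k B x • n :=
    fun x n => rfl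
  { toFun := fun x => F ((toRTensor k B _ N).symm x)
    map_add' := fun x y => by simp only [map_add]
    map_smul' := fun b x => by
      induction x using rtmul_induction with
      | zero => simp only [smul_zero, map_zero]
      | sum x y hx hy => simp only [smul_add, map_add, hx, hy]
      | tmul x n =>
        rw [smul_rtmul, hF, hF, toB_smul]
        simp [mul_smul]
    invFun := fun n => rtmul k B ((toB k B).symm 1) n
    left_inv := fun x => by
      induction x using rtmul_induction with
      | zero => exact (congrArg _ (map_zero F)).trans (TensorProduct.tmul_zero _ _)
      | sum x y hx hy =>
        simp only [map_add] at hx hy ⊢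
        rw [show ∀ m n : N, rtmul k B ((toB k B).symm 1) (m + n) =
          rtmul k B ((toB k B).symm 1) m + rtmul k B ((toB k B).symm 1) n from
          fun m n => TensorProduct.tmul_add _ _ _, hx, hy]
      | tmul x n =>
        change rtmul k B ((toB k B).symm 1) (F ((toRTensor k B _ N).symm (rtmul k B x n))) = _
        rw [hF, rtmul_smul]
        congr 1
        apply (toB k B).injective
        rw [toB_smul]
        simp
    right_inv := fun n => by
      change F ((toRTensor k B _ N).symm (rtmul k B ((toB k B).symm 1) n)) = n
      rw [hF]
      simp }

theorem unitEquiv_rtmul (x : Diag k B) (n : N) :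
    unitEquiv k B N (rtmul k B x n) = toB k B x • n := rfl

end RTensor

/-- An exact sequence `0 → X → T₁ → T₀ → M → 0` with `T₀` and `M` projective remains exact after
tensoring with any module. -/
theorem rTensor_exact_of_projective {B : Type v} [CommRing B] {X T₁ T₀ M : Type*} {N : Type w}
    [AddCommGroup X] [Module B X] [AddCommGroup T₁] [Module B T₁] [AddCommGroup T₀] [Module B T₀]
    [AddCommGroup M] [Module B M] [AddCommGroup N] [Module B N]
    [Module.Projective B T₀] [Module.Projective B M]
    (i : X →ₗ[B] T₁) (d : T₁ →ₗ[B] T₀) (e : T₀ →ₗ[B] M) (hi : Function.Injective i)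
    (hid : Function.Exact i d) (hde : Function.Exact d e) (he : Function.Surjective e) :
    Function.Injective (i.rTensor N) ∧ Function.Exact (i.rTensor N) (d.rTensor N) := by
  obtain ⟨s, hs⟩ := Module.projective_lifting_property e LinearMap.id he
  have hs' : ∀ m, e (s m) = m := LinearMap.congr_fun hs
  let K := LinearMap.ker e
  let ρ : T₀ →ₗ[B] K := LinearMap.codRestrict K (LinearMap.id - s ∘ₗ e) (fun x => by
    rw [LinearMap.mem_ker]
    simp [hs'])
  have hρ : ρ ∘ₗ K.subtype = LinearMap.id := by
    ext x
    have : e x.1 = 0 := x.2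
    simp [ρ, this]
  have : Module.Projective B K := Module.Projective.of_split K.subtype ρ hρ
  let d' : T₁ →ₗ[B] K := d.codRestrict K (fun x => hde.apply_apply_eq_zero x)
  have hd' : Function.Surjective d' := by
    rintro ⟨x, hx⟩
    obtain ⟨y, rfl⟩ := (hde x).1 hx
    exact ⟨y, rfl⟩
  have hid' : Function.Exact i d' := fun x => by
    rw [← hid x]
    exact ⟨fun h => congrArg Subtype.val h, fun h => Subtype.ext h⟩
  have hdd : d = K.subtype ∘ₗ d' := rfl
  obtain ⟨s', hs'⟩ := Module.projective_lifting_property d' LinearMap.id hd'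
  have htf : (Function.Injective i ∧ ∃ l, d' ∘ₗ l = LinearMap.id) ↔
    (Function.Surjective d' ∧ ∃ l, l ∘ₗ i = LinearMap.id) := (hid'.split_tfae').out 0 1
  obtain ⟨-, r, hr⟩ := htf.1 ⟨hi, s', hs'⟩
  constructor
  · apply Function.LeftInverse.injective (g := r.rTensor N)
    intro x
    rw [← LinearMap.comp_apply, ← LinearMap.rTensor_comp, hr, LinearMap.rTensor_id,
      LinearMap.id_apply]
  · intro x
    rw [← rTensor_exact N hid' hd' x, hdd, LinearMap.rTensor_comp, LinearMap.comp_apply]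
    constructor
    · intro h
      have h2 := congrArg (ρ.rTensor N) h
      rwa [map_zero, ← LinearMap.comp_apply, ← LinearMap.rTensor_comp, hρ, LinearMap.rTensor_id,
        LinearMap.id_apply] at h2
    · intro h
      rw [h, map_zero]

variable {k : Type u} {B : Type v} [Field k] [CommRing B] [Algebra k B]

/-- For a 2-extension `ϑ = (0 → B → T → P → B → 0)` of `B ⊗ B`-modules with `P` free, the 2-extension
`ϑ ⊗_B N = (0 → N → T ⊗_B N → P ⊗_B N → N → 0)` of `B`-modules. -/
noncomputable def tensorExt
    (ϑ : TwoExt.{v, v, v, v, v} (B ⊗[k] B) (Diag k B) (Diag k B))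
    (hP : Module.Free (B ⊗[k] B) ϑ.T₀) (N : Type w) [AddCommGroup N] [Module B N] :
    TwoExt.{v, w, w, max v w, max v w} B N N where
  T₁ := RTensor k B ϑ.T₁ N
  T₀ := RTensor k B ϑ.T₀ N
  ι := rmap N ϑ.ι ∘ₗ (unitEquiv k B N).symm.toLinearMap
  d := rmap N ϑ.d
  ε := (unitEquiv k B N).toLinearMap ∘ₗ rmap N ϑ.ε
  ι_injective := by
    have := free_viaRight k B (T := ϑ.T₀)
    exact (rTensor_exact_of_projective (N := N) (rightMap ϑ.ι) (rightMap ϑ.d) (rightMap ϑ.ε)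
      ϑ.ι_injective ϑ.exact₁ ϑ.exact₀ ϑ.ε_surjective).1.comp (unitEquiv k B N).symm.injective
  exact₁ := by
    have := free_viaRight k B (T := ϑ.T₀)
    have h := (rTensor_exact_of_projective (N := N) (rightMap ϑ.ι) (rightMap ϑ.d) (rightMap ϑ.ε)
      ϑ.ι_injective ϑ.exact₁ ϑ.exact₀ ϑ.ε_surjective).2
    intro x
    refine (h x).trans ⟨?_, ?_⟩
    · rintro ⟨y, hy⟩
      exact ⟨unitEquiv k B N y, (congrArg (rmap N ϑ.ι)
        ((unitEquiv k B N).symm_apply_apply y)).trans hy⟩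
    · rintro ⟨n, hn⟩
      exact ⟨(unitEquiv k B N).symm n, hn⟩
  exact₀ := by
    have h := rTensor_exact N (f := rightMap ϑ.d) (g := rightMap ϑ.ε) ϑ.exact₀ ϑ.ε_surjective
    intro x
    rw [LinearMap.comp_apply, LinearEquiv.coe_coe, LinearEquiv.map_eq_zero_iff]
    exact h x
  ε_surjective := (unitEquiv k B N).surjective.comp
    (LinearMap.rTensor_surjective N (g := rightMap ϑ.ε) ϑ.ε_surjective)

theorem directRel_tensorExt
    (ϑ ϑ' : TwoExt.{v, v, v, v, v} (B ⊗[k] B) (Diag k B) (Diag k B)) (h : ϑ.DirectRel ϑ')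
    (hP : Module.Free (B ⊗[k] B) ϑ.T₀) (hP' : Module.Free (B ⊗[k] B) ϑ'.T₀)
    (N : Type w) [AddCommGroup N] [Module B N] :
    TwoExt.DirectRel (tensorExt ϑ hP N) (tensorExt ϑ' hP' N) := by
  obtain ⟨f₁, f₀, h₁, h₂, h₃⟩ := h
  have hcomp : ∀ {T T' T'' : Type v} [AddCommGroup T] [AddCommGroup T'] [AddCommGroup T'']
      [Module (B ⊗[k] B) T] [Module (B ⊗[k] B) T'] [Module (B ⊗[k] B) T'']
      (f : T →ₗ[B ⊗[k] B] T') (g : T' →ₗ[B ⊗[k] B] T'') (x : RTensor k B T N),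
      rmap N g (rmap N f x) = rmap N (g ∘ₗ f) x := by
    intro T T' T'' _ _ _ _ _ _ f g x
    induction x using rtmul_induction with
    | zero => simp only [map_zero]
    | sum x y hx hy => simp only [map_add, hx, hy]
    | tmul x n => rfl
  refine ⟨rmap N f₁, rmap N f₀, ?_, ?_, ?_⟩
  · intro n
    refine (hcomp ϑ.ι f₁ _).trans ?_
    rw [show f₁ ∘ₗ ϑ.ι = ϑ'.ι from LinearMap.ext h₁]
    rfl
  · intro x
    refine (hcomp f₁ ϑ'.d x).trans (Eq.trans ?_ (hcomp ϑ.d f₀ x).symm)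
    rw [show ϑ'.d ∘ₗ f₁ = f₀ ∘ₗ ϑ.d from LinearMap.ext h₂]
  · intro x
    refine congrArg (unitEquiv k B N) ((hcomp f₀ ϑ'.ε x).trans ?_)
    rw [show ϑ'.ε ∘ₗ f₀ = ϑ.ε from LinearMap.ext h₃]

end Hochschild

/-- The map `s : HH²(B|k) → Ex²_B(N, N)`, `[ϑ] ↦ [ϑ ⊗_B N]` for `ϑ = (0 → B → T → P → B → 0)` with `P`
free. It is computed here by replacing an arbitrary `ϑ` by the directly related `ϑ.freeCover`; any
other representative with `P` free gives the same class, see `hochschildAction_mk`. -/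
noncomputable def hochschildAction (k : Type u) (B : Type v) [Field k] [CommRing B] [Algebra k B]
    (N : Type w) [AddCommGroup N] [Module B N] : HH2 k B → Ex2.{v, w, w, max v w} B N N :=
  Quot.lift (fun ϑ => Ex2.mk (Hochschild.tensorExt ϑ.freeCover inferInstance N))
    (fun _ _ h => Quot.sound (Hochschild.directRel_tensorExt _ _ h.freeCover _ _ N))

theorem hochschildAction_mk {k : Type u} {B : Type v} [Field k] [CommRing B] [Algebra k B]
    (N : Type w) [AddCommGroup N] [Module B N]
    (ϑ : TwoExt.{v, v, v, v, v} (B ⊗[k] B) (Hochschild.Diag k B) (Hochschild.Diag k B))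
    (hP : Module.Free (B ⊗[k] B) ϑ.T₀) :
    hochschildAction k B N (Ex2.mk ϑ) = Ex2.mk (Hochschild.tensorExt ϑ hP N) :=
  Quot.sound (Hochschild.directRel_tensorExt _ _ ϑ.directRel_freeCover _ _ N)

/-! Since each of `psi`, `gamma` and `hochschildAction` may be computed with any admissible choice,
it suffices to choose well and then exhibit one morphism of exact sequences from γ(ξ) ⊗_B N to ψ(ξ)
that is the identity on both ends.

On the ψ side the presentation is F = E ⊗ N → N, e ⊗ n ↦ en, with kernel K. As k is a field, F is
projective over E, and B ⊗_E F is just B ⊗ N. On the other side the bar extension pushed out along β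
still has the free module B ⊗ B in degree 0, and (B ⊗ B) ⊗_B N is again B ⊗ N. This identification
is the degree 0 component.

In degree 1, a k-linear section σ of p supplies the elements σ(b) ⊗ n - 1 ⊗ bn of K, and (b₀ ⊗ b₁ ⊗
b₂, n) is sent to b₀ ⊗ (σ(b₁) ⊗ b₂n - 1 ⊗ b₁b₂n) in B ⊗_E K. This is compatible with d₁ because
σ(b₁) acts on B as b₁ (`incl_compare₁`). Both degree 1 terms are pushouts, along β and along ∂. The
map, together with (c, n) ↦ cn on the summand B, descends to them because ∂ takes the image of (x,
n) to β(x)n for every x in ker d₁.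

That identity, `connecting_compare₁`, is the heart of the matter. To compute ∂, lift the image of
(b₀ ⊗ b₁ ⊗ b₂, n) to σ(b₀)(σ(b₁) ⊗ b₂n - 1 ⊗ b₁b₂n) in K. Writing σ(b₀)σ(b₁) = σ(b₀b₁) + i f(b₀,
b₁), the lift becomes i f(b₀, b₁) ⊗ b₂n plus a term that depends only on d₁ of the bar element
(`coe_liftCompare₁`). On ker d₁ only the first term survives. It comes from f(b₀, b₁) ⊗ (1 ⊗ b₂n) in
B ⊗_E F, whose image in N is f(b₀, b₁)b₂n, that is, the value of β. The Hochschild cocycle is thus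
the connecting homomorphism written out. -/

namespace TwoExt

/-! ### Maps into and out of a pushout 2-extension -/

variable {R : Type a} {M : Type b} {N : Type c} [CommRing R]
  [AddCommGroup M] [Module R M] [AddCommGroup N] [Module R N]
  {N' : Type c'} [AddCommGroup N'] [Module R N']

/-- The projection `N' × T₁ → N' ⊕_N T₁`. -/
def pushforwardMk (ϑ : TwoExt.{a, b, c, t₀, t₁} R M N) (α : N →ₗ[R] N') :
    N' × ϑ.T₁ →ₗ[R] (ϑ.pushforward α).T₁ :=
  (ϑ.pushoutRel α).mkQ

theorem pushforwardMk_surjective (ϑ : TwoExt.{a, b, c, t₀, t₁} R M N) (α : N →ₗ[R] N') :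
    Function.Surjective (ϑ.pushforwardMk α) :=
  Submodule.mkQ_surjective _

theorem pushforwardMk_eq_zero (ϑ : TwoExt.{a, b, c, t₀, t₁} R M N) (α : N →ₗ[R] N') (n : N) :
    ϑ.pushforwardMk α (α n, -ϑ.ι n) = 0 :=
  (Submodule.Quotient.mk_eq_zero _).2 ⟨n, rfl⟩

/-- The additive map out of the pushout `N' ⊕_N T₁` induced by an additive map on `N' × T₁`. -/
def pushforwardLift (ϑ : TwoExt.{a, b, c, t₀, t₁} R M N) (α : N →ₗ[R] N')
    {A : Type*} [AddCommGroup A] (φ : N' × ϑ.T₁ →+ A) (h : ∀ n, φ (α n, -ϑ.ι n) = 0) :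
    (ϑ.pushforward α).T₁ →+ A :=
  -- Only additivity is used, so A need not be an R-module. In the application R is B ⊗ B and A is a
  -- group of additive maps out of N.
  QuotientAddGroup.lift (ϑ.pushoutRel α).toAddSubgroup φ (by
    rintro _ ⟨n, rfl⟩
    exact h n)

end TwoExt

/-! ### Maps out of T ⊗_B N -/

namespace Hochschild

section RTensorLift

variable {k : Type u} {B : Type v} [CommRing k] [CommRing B] [Algebra k B]
  {T : Type t} [AddCommGroup T] [Module (B ⊗[k] B) T] {N : Type w} [AddCommGroup N] [Module B N]
  {A : Type*} [AddCommGroup A] [Module B A]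

/-- The `B`-linear map `T ⊗_B N → A` induced by a biadditive map `T × N → A` which is balanced
with respect to the right `B`-action on `T` and linear with respect to the left one. -/
noncomputable def rtensorLift (φ : T →+ N →+ A)
    (hr : ∀ b x n, φ ((1 ⊗ₜ[k] b : B ⊗[k] B) • x) n = φ x (b • n))
    (hl : ∀ b x n, φ ((b ⊗ₜ[k] 1 : B ⊗[k] B) • x) n = b • φ x n) :
    RTensor k B T N →ₗ[B] A :=
  -- Balance for the right action is all that the tensor product over B requires. The left action,
  -- which becomes the module structure of T ⊗_B N, enters only afterwards, in `map_smul'`.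
  let F : ViaRight k B T ⊗[B] N →+ A :=
    TensorProduct.liftAddHom (φ.comp (toRight k B T).symm.toAddMonoidHom) hr
  { toFun := fun x => F ((toRTensor k B T N).symm x)
    map_add' := fun x y => by simp only [map_add]
    map_smul' := fun b x => by
      induction x using rtmul_induction with
      | zero => simp only [smul_zero, map_zero]
      | sum x y hx hy => simp only [smul_add, map_add, hx, hy]
      | tmul x n => exact hl b x n }

theorem rtensor_hom_ext {f g : RTensor k B T N →ₗ[B] A}
    (h : ∀ x n, f (rtmul k B x n) = g (rtmul k B x n)) : f = g := by
  ext x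
  induction x using rtmul_induction with
  | zero => rw [map_zero, map_zero]
  | sum x y hx hy => rw [map_add, map_add, hx, hy]
  | tmul x n => exact h x n

end RTensorLift

/-- Induction on elements of `B ⊗ B ⊗ B`. -/
theorem bar_induction {k : Type u} {B : Type v} [CommRing k] [CommRing B] [Algebra k B]
    {p : (B ⊗[k] B) ⊗[k] B → Prop} (x : (B ⊗[k] B) ⊗[k] B) (zero : p 0)
    (tmul : ∀ b₀ b₁ b₂, p ((b₀ ⊗ₜ b₂) ⊗ₜ b₁)) (sum : ∀ x y, p x → p y → p (x + y)) : p x := by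
  induction x with
  | zero => exact zero
  | add y z hy hz => exact sum y z hy hz
  | tmul x b₁ =>
    induction x with
    | zero => simpa using zero
    | add y z hy hz => simpa only [TensorProduct.add_tmul] using sum _ _ hy hz
    | tmul b₀ b₂ => exact tmul b₀ b₁ b₂

/-! ### Maps on (B ⊗ B) × N and (B ⊗ B ⊗ B) × N in which the last factor acts on N -/

section Multilinear

variable {k : Type u} {B : Type v} [CommRing k] [CommRing B] [Algebra k B]
  {N : Type w} [AddCommGroup N] [Module B N] [Module k N] [IsScalarTower k B N]
  {A : Type*} [AddCommGroup A] [Module k A]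

/-- The map `(b ⊗ b', n) ↦ φ(b, b' n)`. -/
noncomputable def actLift₂ (φ : B →ₗ[k] N →ₗ[k] A) : B ⊗[k] B →ₗ[k] N →ₗ[k] A :=
  TensorProduct.lift (LinearMap.mk₂ k (fun b b' => φ b ∘ₗ Algebra.lsmul k k N b')
    (fun x y z => by ext; simp) (fun r x z => by ext; simp)
    (fun x y z => by ext; simp) (fun r x z => by ext; simp))

theorem actLift₂_tmul (φ : B →ₗ[k] N →ₗ[k] A) (b b' : B) (n : N) :
    actLift₂ φ (b ⊗ₜ b') n = φ b (b' • n) := by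
  simp [actLift₂]

/-- The map `(b₀ ⊗ b₁ ⊗ b₂, n) ↦ φ(b₀, b₁, b₂ n)`
(with `b₀ ⊗ b₁ ⊗ b₂` written as `(b₀ ⊗ b₂) ⊗ b₁`). -/
noncomputable def actLift₃ (φ : B →ₗ[k] B →ₗ[k] N →ₗ[k] A) :
    (B ⊗[k] B) ⊗[k] B →ₗ[k] N →ₗ[k] A :=
  TensorProduct.lift (TensorProduct.lift (LinearMap.mk₂ k
    (fun b₀ b₂ => (Algebra.lsmul k k N b₂).lcomp k A ∘ₗ φ b₀)
    (fun x y z => by ext; simp) (fun r x z => by ext; simp)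
    (fun x y z => by ext; simp) (fun r x z => by ext; simp)))

theorem actLift₃_tmul (φ : B →ₗ[k] B →ₗ[k] N →ₗ[k] A) (b₀ b₁ b₂ : B) (n : N) :
    actLift₃ φ ((b₀ ⊗ₜ b₂) ⊗ₜ b₁) n = φ b₀ b₁ (b₂ • n) := by
  simp [actLift₃]

/-- The right outer factor enters only through its action on n. With its analogue for `actLift₃`,
this gives the balance condition needed to pass to ⊗_B N. -/
theorem actLift₂_smul_right (φ : B →ₗ[k] N →ₗ[k] A) (b : B) (x : B ⊗[k] B) (n : N) :
    actLift₂ φ ((1 ⊗ₜ[k] b : B ⊗[k] B) • x) n = actLift₂ φ x (b • n) := by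
  induction x with
  | zero => simp
  | add y z hy hz => simp only [smul_add, map_add, LinearMap.add_apply, hy, hz]
  | tmul b₀ b₁ =>
    rw [smul_eq_mul, Algebra.TensorProduct.tmul_mul_tmul, actLift₂_tmul, actLift₂_tmul, one_mul,
      mul_comm, mul_smul]

theorem actLift₃_smul_right (φ : B →ₗ[k] B →ₗ[k] N →ₗ[k] A) (b : B) (x : (B ⊗[k] B) ⊗[k] B)
    (n : N) : actLift₃ φ ((1 ⊗ₜ[k] b : B ⊗[k] B) • x) n = actLift₃ φ x (b • n) := by
  induction x using bar_induction with
  | zero => simp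
  | sum y z hy hz => simp only [smul_add, map_add, LinearMap.add_apply, hy, hz]
  | tmul b₀ b₁ b₂ =>
    rw [TensorProduct.smul_tmul', smul_eq_mul, Algebra.TensorProduct.tmul_mul_tmul,
      actLift₃_tmul, actLift₃_tmul, one_mul, mul_comm, mul_smul]

variable [Module B A]

/-- The left outer factor is the first argument of φ, so left linearity of φ there is all that is
needed. -/
theorem actLift₂_smul_left (φ : B →ₗ[k] N →ₗ[k] A) (hφ : ∀ b c n, φ (b * c) n = b • φ c n)
    (b : B) (x : B ⊗[k] B) (n : N) :
    actLift₂ φ ((b ⊗ₜ[k] 1 : B ⊗[k] B) • x) n = b • actLift₂ φ x n := by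
  induction x with
  | zero => simp
  | add y z hy hz => simp only [smul_add, map_add, LinearMap.add_apply, hy, hz]
  | tmul b₀ b₁ =>
    rw [smul_eq_mul, Algebra.TensorProduct.tmul_mul_tmul, actLift₂_tmul, actLift₂_tmul, one_mul,
      hφ]

theorem actLift₃_smul_left (φ : B →ₗ[k] B →ₗ[k] N →ₗ[k] A)
    (hφ : ∀ b c d n, φ (b * c) d n = b • φ c d n) (b : B) (x : (B ⊗[k] B) ⊗[k] B) (n : N) :
    actLift₃ φ ((b ⊗ₜ[k] 1 : B ⊗[k] B) • x) n = b • actLift₃ φ x n := by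
  induction x using bar_induction with
  | zero => simp
  | sum y z hy hz => simp only [smul_add, map_add, LinearMap.add_apply, hy, hz]
  | tmul b₀ b₁ b₂ =>
    rw [TensorProduct.smul_tmul', smul_eq_mul, Algebra.TensorProduct.tmul_mul_tmul,
      actLift₃_tmul, actLift₃_tmul, one_mul, hφ]

end Multilinear

end Hochschild

/-! ### Maps into B ⊗_E (E ⊗ N) -/

namespace InfExt

open Hochschild

instance isScalarTower_base {k : Type u} {B : Type v} [CommRing k] [CommRing B] [Algebra k B]
    (ξ : InfExt.{u, v, v} k B B) : IsScalarTower k ξ.E B :=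
  IsScalarTower.of_algebraMap_eq fun r => (ξ.p.commutes r).symm

theorem smul_eq_p_smul {k : Type u} {B : Type v} [CommRing k] [CommRing B] [Algebra k B]
    (ξ : InfExt.{u, v, v} k B B) {N : Type w} [AddCommGroup N] [Module B N] [Module ξ.E N]
    [IsScalarTower ξ.E B N] (e : ξ.E) (n : N) : e • n = ξ.p e • n :=
  (algebraMap_smul B e n).symm

section BaseChange

variable {k : Type u} {B : Type v} [CommRing k] [CommRing B] [Algebra k B]
  (ξ : InfExt.{u, v, v} k B B)

variable (N : Type w) [AddCommGroup N] [Module k N]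

/-- The map `(b, n) ↦ b ⊗ (1 ⊗ n)` from `B × N` to `B ⊗_E (E ⊗ N)`. -/
noncomputable def tmulOne : B →ₗ[k] N →ₗ[k] B ⊗[ξ.E] (ξ.E ⊗[k] N) :=
  LinearMap.mk₂ k (fun b n => b ⊗ₜ[ξ.E] (1 ⊗ₜ[k] n))
    (fun x y n => TensorProduct.add_tmul _ _ _)
    (fun r x n => (TensorProduct.smul_tmul' _ _ _).symm)
    (fun x m n => by simp only [TensorProduct.tmul_add])
    (fun r x n => by simp only [TensorProduct.tmul_smul])

variable [Module B N] [IsScalarTower k B N]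

/-- The map `(b ⊗ b', n) ↦ b ⊗ (1 ⊗ b' n)` from `(B ⊗ B) × N` to `B ⊗_E (E ⊗ N)`. -/
noncomputable def compare₀ : B ⊗[k] B →ₗ[k] N →ₗ[k] B ⊗[ξ.E] (ξ.E ⊗[k] N) :=
  actLift₂ (ξ.tmulOne N)

theorem compare₀_tmul (b b' : B) (n : N) :
    ξ.compare₀ N (b ⊗ₜ b') n = b ⊗ₜ[ξ.E] (1 ⊗ₜ[k] (b' • n)) := actLift₂_tmul _ _ _ _

variable (σ : B →ₗ[k] ξ.E) (hσ : ∀ b, ξ.p (σ b) = b)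

/-- The map `(b₀ ⊗ b₁ ⊗ b₂, n) ↦ f(b₀, b₁) ⊗ (1 ⊗ b₂ n)`, where `f` is the cocycle of `σ`. -/
noncomputable def cocycleLift :
    (B ⊗[k] B) ⊗[k] B →ₗ[k] N →ₗ[k] B ⊗[ξ.E] (ξ.E ⊗[k] N) :=
  actLift₃ ((ξ.cocycle σ hσ).compr₂ (ξ.tmulOne N))

theorem cocycleLift_tmul (b₀ b₁ b₂ : B) (n : N) :
    ξ.cocycleLift N σ hσ ((b₀ ⊗ₜ b₂) ⊗ₜ b₁) n =
      ξ.cocycle σ hσ b₀ b₁ ⊗ₜ[ξ.E] (1 ⊗ₜ[k] (b₂ • n)) :=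
  actLift₃_tmul _ _ _ _ _

end BaseChange

/-! ### The presentation E ⊗ N → N, the comparison with the bar complex, and its lift to K -/

section Comparison

variable {k : Type u} {B : Type v} [CommRing k] [CommRing B] [Algebra k B]
  (ξ : InfExt.{u, v, v} k B B)
  (N : Type w) [AddCommGroup N] [Module k N] [Module ξ.E N] [IsScalarTower k ξ.E N]

/-- The presentation `E ⊗ N → N`, `e ⊗ n ↦ e n`. -/
noncomputable def tensorPres : ξ.E ⊗[k] N →ₗ[ξ.E] N :=
  (LinearMap.id : N →ₗ[k] N).liftBaseChange ξ.E

theorem tensorPres_tmul (e : ξ.E) (n : N) : ξ.tensorPres N (e ⊗ₜ n) = e • n := by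
  simp [tensorPres]

theorem tensorPres_surjective : Function.Surjective (ξ.tensorPres N) :=
  fun n => ⟨1 ⊗ₜ n, by rw [tensorPres_tmul, one_smul]⟩

variable [Module B N] [IsScalarTower k B N] [IsScalarTower ξ.E B N]

variable (σ : B →ₗ[k] ξ.E) (hσ : ∀ b, ξ.p (σ b) = b)

/-- The elements `σ(b) ⊗ n - 1 ⊗ b n` of the kernel of `E ⊗ N → N`. -/
noncomputable def syzygy : B →ₗ[k] N →ₗ[k] LinearMap.ker (ξ.tensorPres N) :=
  LinearMap.mk₂ k (fun b n => ⟨σ b ⊗ₜ n - 1 ⊗ₜ (b • n), by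
      -- σ(b) acts on N through p(σ(b)) = b, so both terms map to bn.
      rw [LinearMap.mem_ker, map_sub, tensorPres_tmul, tensorPres_tmul, smul_eq_p_smul, hσ,
        one_smul, sub_self]⟩)
    (fun x y n => Subtype.ext (by
      simp only [Submodule.coe_add, map_add, TensorProduct.add_tmul, TensorProduct.tmul_add,
        add_smul]
      abel))
    (fun r x n => Subtype.ext (by
      simp only [Submodule.coe_smul_of_tower, map_smul, smul_assoc, TensorProduct.tmul_smul,
        TensorProduct.smul_tmul', smul_sub]))
    (fun x m n => Subtype.ext (by
      simp only [Submodule.coe_add, TensorProduct.tmul_add, smul_add]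
      abel))
    (fun r x n => Subtype.ext (by
      simp only [Submodule.coe_smul_of_tower, smul_comm x r n, TensorProduct.tmul_smul, smul_sub]))

theorem coe_syzygy (b : B) (n : N) :
    (ξ.syzygy N σ hσ b n : ξ.E ⊗[k] N) = σ b ⊗ₜ n - 1 ⊗ₜ (b • n) := rfl

/-- The map `(b₀ ⊗ b₁ ⊗ b₂, n) ↦ b₀ ⊗ (σ(b₁) ⊗ b₂ n - 1 ⊗ b₁ b₂ n)` from `(B ⊗ B ⊗ B) × N`
to `B ⊗_E K`, where `K` is the kernel of `E ⊗ N → N`. -/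
noncomputable def compare₁ :
    (B ⊗[k] B) ⊗[k] B →ₗ[k] N →ₗ[k] B ⊗[ξ.E] LinearMap.ker (ξ.tensorPres N) :=
  actLift₃ (LinearMap.mk₂ k
    (fun b₀ b₁ => (TensorProduct.mk ξ.E B _ b₀).restrictScalars k ∘ₗ ξ.syzygy N σ hσ b₁)
    (fun x y b => by ext; simp)
    (fun r x b => by ext; simp [TensorProduct.smul_tmul'])
    (fun x b c => by ext; simp [TensorProduct.tmul_add])
    (fun r x b => by ext; simp))

theorem compare₁_tmul (b₀ b₁ b₂ : B) (n : N) :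
    ξ.compare₁ N σ hσ ((b₀ ⊗ₜ b₂) ⊗ₜ b₁) n = b₀ ⊗ₜ[ξ.E] ξ.syzygy N σ hσ b₁ (b₂ • n) :=
  actLift₃_tmul _ _ _ _ _

/-- The comparison is a chain map: in B ⊗_E (E ⊗ N) the two terms of a syzygy turn into the two
terms of d₁. -/
theorem incl_compare₁ (x : (B ⊗[k] B) ⊗[k] B) (n : N) :
    Psi.incl B (ξ.tensorPres N) (ξ.compare₁ N σ hσ x n) = ξ.compare₀ N (d₁ k B x) n := by
  induction x using bar_induction with
  | zero => simp
  | sum y z hy hz => simp only [map_add, LinearMap.add_apply, hy, hz]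
  | tmul b₀ b₁ b₂ =>
    -- σ(b₁) ⊗ m is σ(b₁) times 1 ⊗ m. The scalar crosses the tensor product over E and acts on B
    -- through p, as b₁.
    have h : ∀ m : N, b₀ ⊗ₜ[ξ.E] (σ b₁ ⊗ₜ[k] m) = (b₀ * b₁) ⊗ₜ[ξ.E] ((1 : ξ.E) ⊗ₜ[k] m) := by
      intro m
      rw [← mul_one (σ b₁), ← smul_eq_mul, ← TensorProduct.smul_tmul', ← TensorProduct.smul_tmul,
        Algebra.smul_def, algebraMap_eq, hσ, mul_comm]
    rw [compare₁_tmul, d₁_tmul, map_sub, LinearMap.sub_apply, compare₀_tmul, compare₀_tmul]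
    simp [Psi.incl, coe_syzygy, TensorProduct.tmul_sub, h, mul_smul]

/-- The map `(b₀ ⊗ b₁ ⊗ b₂, n) ↦ σ(b₀) (σ(b₁) ⊗ b₂ n - 1 ⊗ b₁ b₂ n)`, which lifts `compare₁`
to the kernel `K` of `E ⊗ N → N`. -/
noncomputable def liftCompare₁ :
    (B ⊗[k] B) ⊗[k] B →ₗ[k] N →ₗ[k] LinearMap.ker (ξ.tensorPres N) :=
  actLift₃ (A := LinearMap.ker (ξ.tensorPres N)) (LinearMap.mk₂ k
    (fun b₀ b₁ => Algebra.lsmul k k (LinearMap.ker (ξ.tensorPres N)) (σ b₀) ∘ₗ ξ.syzygy N σ hσ b₁)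
    (fun x y b => by ext; simp)
    (fun r x b => by ext; simp)
    (fun x b c => by ext; simp [smul_add])
    (fun r x b => by ext; simp [smul_comm r (σ _)]))

theorem liftCompare₁_tmul (b₀ b₁ b₂ : B) (n : N) :
    ξ.liftCompare₁ N σ hσ ((b₀ ⊗ₜ b₂) ⊗ₜ b₁) n = σ b₀ • ξ.syzygy N σ hσ b₁ (b₂ • n) :=
  actLift₃_tmul _ _ _ _ _

/-- The scalar σ(b₀) crosses ⊗_E and becomes b₀, so this is a legitimate lift for the snake lemma.
As σ is only k-linear, the lift need not respect the left B-action; that is harmless, since ∂ is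
evaluated one element at a time. -/
theorem one_tmul_liftCompare₁ (x : (B ⊗[k] B) ⊗[k] B) (n : N) :
    (1 : B) ⊗ₜ[ξ.E] ξ.liftCompare₁ N σ hσ x n = ξ.compare₁ N σ hσ x n := by
  induction x using bar_induction with
  | zero => simp
  | sum y z hy hz =>
    simp only [map_add, LinearMap.add_apply, TensorProduct.tmul_add, hy, hz]
  | tmul b₀ b₁ b₂ =>
    rw [compare₁_tmul, liftCompare₁_tmul, ← TensorProduct.smul_tmul, Algebra.smul_def,
      algebraMap_eq, hσ, mul_one]

/-- The final step of the snake, from B ⊗_E F to N, recovers the formula defining β. -/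
theorem aug_cocycleLift (x : (B ⊗[k] B) ⊗[k] B) (n : N) :
    Psi.aug B (ξ.tensorPres N) (ξ.cocycleLift N σ hσ x n) =
      betaMap (ξ.cocycle σ hσ) x • n := by
  induction x using bar_induction with
  | zero => simp
  | sum y z hy hz => simp only [map_add, LinearMap.add_apply, add_smul, hy, hz]
  | tmul b₀ b₁ b₂ =>
    rw [cocycleLift_tmul, Psi.aug_tmul, tensorPres_tmul, betaMap_tmul, one_smul, mul_smul]

/-- This is the cocycle identity σ(b₀)σ(b₁) = i f(b₀, b₁) + σ(b₀b₁), tensored with b₂n. The terms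
σ(b₀b₁) ⊗ b₂n - σ(b₀) ⊗ b₁b₂n that remain depend on x only through d₁ x, and so vanish on ker d₁. -/
theorem coe_liftCompare₁ (x : (B ⊗[k] B) ⊗[k] B) (n : N) :
    (ξ.liftCompare₁ N σ hσ x n : ξ.E ⊗[k] N) =
      TensorProduct.lid ξ.E _ (ξ.iE.rTensor _ (ξ.cocycleLift N σ hσ x n)) +
        actLift₂ (TensorProduct.mk k ξ.E N ∘ₗ σ) (d₁ k B x) n := by
  induction x using bar_induction with
  | zero => simp
  | sum y z hy hz =>
    simp only [map_add, LinearMap.add_apply, Submodule.coe_add, hy, hz]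
    abel
  | tmul b₀ b₁ b₂ =>
    have h : ξ.iE (ξ.cocycle σ hσ b₀ b₁) = σ b₀ * σ b₁ - σ (b₀ * b₁) := ξ.i_cocycle σ hσ b₀ b₁
    rw [liftCompare₁_tmul, cocycleLift_tmul, d₁_tmul, map_sub, LinearMap.sub_apply,
      actLift₂_tmul, actLift₂_tmul, LinearMap.rTensor_tmul, TensorProduct.lid_tmul, h,
      SetLike.val_smul, coe_syzygy]
    simp [TensorProduct.smul_tmul', smul_sub, mul_smul, TensorProduct.sub_tmul]

end Comparison

end InfExt

namespace InfExt

open Hochschild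

/-! ### ∂ corresponds to β, and the resulting morphism of 2-extensions -/

section DirectRel

variable {k : Type u} {B : Type v} [Field k] [CommRing B] [Algebra k B]
  (ξ : InfExt.{u, v, v} k B B)
  (N : Type w) [AddCommGroup N] [Module k N] [Module ξ.E N] [IsScalarTower k ξ.E N]
  [Module B N] [IsScalarTower k B N] [IsScalarTower ξ.E B N]
  (σ : B →ₗ[k] ξ.E) (hσ : ∀ b, ξ.p (σ b) = b)

theorem compare₁_mem_Tor1 {x : (B ⊗[k] B) ⊗[k] B} (hx : d₁ k B x = 0) (n : N) :
    ξ.compare₁ N σ hσ x n ∈ Psi.Tor1 B (ξ.tensorPres N) := by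
  rw [LinearMap.mem_ker, incl_compare₁, hx, map_zero, LinearMap.zero_apply]

/-- A snake chase with explicit choices: `liftCompare₁` is the lift to K, and for d₁ x = 0 it is the
image under i of `cocycleLift`, which the augmentation sends to β(x)n. -/
theorem connecting_compare₁ {x : (B ⊗[k] B) ⊗[k] B} (hx : d₁ k B x = 0) (n : N) :
    Psi.connecting ξ.p_surjective ξ.iE ξ.i_injective ξ.exact (ξ.tensorPres N)
      (ξ.tensorPres_surjective N) ⟨_, ξ.compare₁_mem_Tor1 N σ hσ hx n⟩ =
      betaMap (ξ.cocycle σ hσ) x • n := by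
  rw [← aug_cocycleLift]
  refine Psi.connecting_eq_of_lid _ _ _ _ _ _ _ (ξ.liftCompare₁ N σ hσ x n)
    (ξ.one_tmul_liftCompare₁ N σ hσ x n) _ ?_
  rw [coe_liftCompare₁, hx, map_zero, LinearMap.zero_apply, add_zero]

/-- The projection of `N × (B ⊗_E K)` onto the pushout which is the middle term of `ξ.psiExt`. -/
noncomputable def psiMk : N × (B ⊗[ξ.E] LinearMap.ker (ξ.tensorPres N)) →ₗ[B]
    (ξ.psiExt (ξ.tensorPres N) (ξ.tensorPres_surjective N)).T₁ :=
  (Psi.theta ξ.p_surjective (ξ.tensorPres N) (ξ.tensorPres_surjective N)).pushforwardMk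
    (Psi.connecting ξ.p_surjective ξ.iE ξ.i_injective ξ.exact (ξ.tensorPres N)
      (ξ.tensorPres_surjective N))

/-- By `connecting_compare₁` the first entry is ∂ of the negative of the second, so the pair is a
relator of the pushout along ∂. Hence relators of the pushout along β go to zero. -/
theorem psiMk_eq_zero {x : (B ⊗[k] B) ⊗[k] B} (hx : d₁ k B x = 0) (n : N) :
    ξ.psiMk N (betaMap (ξ.cocycle σ hσ) x • n, -ξ.compare₁ N σ hσ x n) = 0 := by
  rw [← ξ.connecting_compare₁ N σ hσ hx n]
  exact TwoExt.pushforwardMk_eq_zero _ _ _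

/-- The biadditive map `((c, x), n) ↦ (c n, compare₁(x, n))` from `(B × B ⊗ B ⊗ B) × N` to
`N × (B ⊗_E K)`. -/
noncomputable def comparePair : B × (B ⊗[k] B) ⊗[k] B →+ N →+
    N × (B ⊗[ξ.E] LinearMap.ker (ξ.tensorPres N)) :=
  AddMonoidHom.mk' (fun x =>
      (DistribSMul.toAddMonoidHom N x.1).prod (ξ.compare₁ N σ hσ x.2).toAddMonoidHom)
    (fun x y => AddMonoidHom.ext fun n => Prod.ext (add_smul x.1 y.1 n) (by
      change ξ.compare₁ N σ hσ (x.2 + y.2) n = ξ.compare₁ N σ hσ x.2 n + ξ.compare₁ N σ hσ y.2 n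
      rw [map_add, LinearMap.add_apply]))

/-- The projection of `B × (B ⊗ B ⊗ B)` onto the pushout which is the middle term of
`ξ.gammaExt`. -/
noncomputable def gammaMk :
    Diag k B × (B ⊗[k] B) ⊗[k] B →ₗ[B ⊗[k] B] (ξ.gammaExt σ hσ).T₁ :=
  (barExt k B).pushforwardMk (beta (ξ.cocycle σ hσ) (ξ.cocycle_condition σ hσ))

theorem gammaMk_surjective : Function.Surjective (ξ.gammaMk σ hσ) :=
  (barExt k B).pushforwardMk_surjective _

/-- The biadditive map from `W × N` to the middle term of `ξ.psiExt`, where `W` is the middle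
term of `ξ.gammaExt`. -/
noncomputable def compareMap : (ξ.gammaExt σ hσ).T₁ →+ N →+
    (ξ.psiExt (ξ.tensorPres N) (ξ.tensorPres_surjective N)).T₁ :=
  (barExt k B).pushforwardLift (beta (ξ.cocycle σ hσ) (ξ.cocycle_condition σ hσ))
    ((AddMonoidHom.compHom (ξ.psiMk N).toAddMonoidHom).comp (ξ.comparePair N σ hσ)) (by
      -- The relator attached to z in ker d₁ is (β(z), -z).
      intro z
      ext n
      change ξ.psiMk N (betaMap (ξ.cocycle σ hσ) z.1 • n, ξ.compare₁ N σ hσ (-z.1) n) = 0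
      rw [map_neg, LinearMap.neg_apply, ξ.psiMk_eq_zero N σ hσ z.2 n])

theorem compareMap_mk (x : Diag k B × (B ⊗[k] B) ⊗[k] B) (n : N) :
    ξ.compareMap N σ hσ (ξ.gammaMk σ hσ x) n =
      ξ.psiMk N (toB k B x.1 • n, ξ.compare₁ N σ hσ x.2 n) := rfl

theorem compareMap_smul_right (b : B) (x : (ξ.gammaExt σ hσ).T₁) (n : N) :
    ξ.compareMap N σ hσ ((1 ⊗ₜ[k] b : B ⊗[k] B) • x) n = ξ.compareMap N σ hσ x (b • n) := by
  obtain ⟨x, rfl⟩ := ξ.gammaMk_surjective σ hσ x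
  rw [← map_smul, compareMap_mk, compareMap_mk]
  refine congrArg (ξ.psiMk N) (Prod.ext ?_ (actLift₃_smul_right _ b x.2 n))
  change toB k B ((1 ⊗ₜ[k] b : B ⊗[k] B) • x.1) • n = toB k B x.1 • b • n
  rw [toB_smul, Algebra.TensorProduct.lmul'_apply_tmul, one_mul, mul_comm, mul_smul]

/-- b multiplies c on the summand B and b₀ on the bar summand. The latter is the left factor of B
⊗_E K, through which B acts there. -/
theorem compareMap_smul_left (b : B) (x : (ξ.gammaExt σ hσ).T₁) (n : N) :
    ξ.compareMap N σ hσ ((b ⊗ₜ[k] 1 : B ⊗[k] B) • x) n = b • ξ.compareMap N σ hσ x n := by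
  obtain ⟨x, rfl⟩ := ξ.gammaMk_surjective σ hσ x
  rw [← map_smul, compareMap_mk, compareMap_mk, ← map_smul (ξ.psiMk N)]
  refine congrArg (ξ.psiMk N) (Prod.ext ?_ (actLift₃_smul_left _
    (fun b c d n => (TensorProduct.smul_tmul' b c _).symm) b x.2 n))
  change toB k B ((b ⊗ₜ[k] 1 : B ⊗[k] B) • x.1) • n = b • toB k B x.1 • n
  rw [toB_smul, Algebra.TensorProduct.lmul'_apply_tmul, mul_one, mul_smul]

/-- The map `(B ⊗ B) ⊗_B N → B ⊗_E (E ⊗ N)` induced by `compare₀`. -/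
noncomputable def compareMap₀ : RTensor k B (B ⊗[k] B) N →ₗ[B] B ⊗[ξ.E] (ξ.E ⊗[k] N) :=
  rtensorLift (AddMonoidHom.mk' (fun x => (ξ.compare₀ N x).toAddMonoidHom)
      (fun x y => by rw [map_add]; rfl))
    (actLift₂_smul_right _)
    (actLift₂_smul_left _ fun b c _ => (TensorProduct.smul_tmul' b c _).symm)

/-- There is a morphism of 2-extensions from `ξ.gammaExt ⊗_B N` to `ξ.psiExt`. -/
theorem directRel_tensorExt_psiExt (hP : Module.Free (B ⊗[k] B) (ξ.gammaExt σ hσ).T₀) :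
    TwoExt.DirectRel (tensorExt (ξ.gammaExt σ hσ) hP N)
      (ξ.psiExt (ξ.tensorPres N) (ξ.tensorPres_surjective N)) := by
  let Γ := tensorExt (ξ.gammaExt σ hσ) hP N
  let Ψ := ξ.psiExt (ξ.tensorPres N) (ξ.tensorPres_surjective N)
  let f₁ : Γ.T₁ →ₗ[B] Ψ.T₁ := rtensorLift (ξ.compareMap N σ hσ) (ξ.compareMap_smul_right N σ hσ)
    (ξ.compareMap_smul_left N σ hσ)
  let f₀ : Γ.T₀ →ₗ[B] Ψ.T₀ := ξ.compareMap₀ N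
  refine ⟨f₁, f₀, ?_, ?_, ?_⟩
  · intro n
    -- The inverse of B ⊗_B N ≅ N sends n to 1 ⊗ n, so the left end is represented by the pair (1,
    -- 0) together with n.
    change ξ.psiMk N ((1 : B) • n, ξ.compare₁ N σ hσ 0 n) = ξ.psiMk N (n, 0)
    rw [one_smul, map_zero, LinearMap.zero_apply]
  · refine LinearMap.congr_fun (show Ψ.d ∘ₗ f₁ = f₀ ∘ₗ Γ.d from
      rtensor_hom_ext (T := (ξ.gammaExt σ hσ).T₁) fun x n => ?_)
    -- On a representative (c, x) both differentials ignore c, which leaves the chain map identity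
    -- for x.
    obtain ⟨x, rfl⟩ := ξ.gammaMk_surjective σ hσ x
    exact ξ.incl_compare₁ N σ hσ x.2 n
  · refine LinearMap.congr_fun (show Ψ.ε ∘ₗ f₀ = Γ.ε from
      rtensor_hom_ext (T := B ⊗[k] B) fun x n => ?_)
    change Psi.aug B (ξ.tensorPres N) (ξ.compare₀ N x n) = Algebra.TensorProduct.lmul' k x • n
    induction x using TensorProduct.induction_on with
    | zero => simp
    | add x y hx hy => simp only [map_add, LinearMap.add_apply, add_smul, hx, hy]
    | tmul b b' =>
      rw [compare₀_tmul, Psi.aug_tmul, tensorPres_tmul, one_smul,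
        Algebra.TensorProduct.lmul'_apply_tmul, mul_smul]

end DirectRel

end InfExt

/-! ### The theorem -/

theorem theorem4p1 (k : Type u) [Field k] (B : Type v) [CommRing B] [Algebra k B]
    (N : Type w) [AddCommGroup N] [Module B N] :
    psi k B N = hochschildAction k B N ∘ gamma k B := by
  funext x
  obtain ⟨ξ, rfl⟩ := Quot.exists_rep x
  obtain ⟨σ, hσ⟩ := ξ.exists_section
  let := ξ.moduleRes N
  have := ξ.isScalarTower_moduleRes N
  -- N carries only a B-module structure. Its k- and E-structures are obtained by restriction, and
  -- they are compatible because p is a k-algebra map.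
  let : Module k N := Module.compHom N (algebraMap k B)
  have : IsScalarTower k B N := IsScalarTower.of_algebraMap_smul fun _ _ => rfl
  have : IsScalarTower k ξ.E N := IsScalarTower.of_algebraMap_smul fun r n => by
    rw [ξ.smul_eq_p_smul, AlgHom.commutes, algebraMap_smul]
  -- Pushing out along β leaves the degree 0 term B ⊗ B of the bar extension unchanged, so no free
  -- cover is needed.
  have hP : Module.Free (B ⊗[k] B) (ξ.gammaExt σ hσ).T₀ :=
    inferInstanceAs (Module.Free (B ⊗[k] B) (B ⊗[k] B))
  change psi k B N (Exal.mk ξ) = hochschildAction k B N (gamma k B (Exal.mk ξ))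
  rw [psi_mk ξ (ξ.tensorPres N) (ξ.tensorPres_surjective N), gamma_mk ξ σ hσ, hochschildAction_mk N _ hP]
  -- The morphism runs from s(γ(ξ)) to ψ(ξ), hence the `symm`.
  exact (Quot.sound (ξ.directRel_tensorExt_psiExt N σ hσ hP)).symm
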